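/- Let $n\ge 3$ and $K\in[1,\infty)$. There is a constant $C=C(n,K)\in(0,\infty)$ and, for every $W\in(0,\infty)$, a constant $\varepsilon=\varepsilon(n,K,W)>0$ such that the following holds. Let $A\subset\mathbb R^n$ be a non-empty open set and let $g$ be a smooth Riemannian metric on the cylinder $A\times\mathbb R\subset\mathbb R^{n+1}$ such that $$\frac1K\langle X,X\rangle\le g_x(X,X)\le K\langle X,X\rangle\qquad\text{for all }x\in A\times\mathbb R,\ X\in\mathbb R^{n+1},$$ where $\langle\cdot,\cdot\rangle$ is the Euclidean inner product of $\mathbb R^{n+1}$. Let $T\in\mathbb R$, let $u\colon A\to(-T,T)$ be a smooth function with $\|\nabla^{\mathbb R^n}u\|_{L^\infty(A)}\le\frac12$ (Euclidean gradient), and let $M=\operatorname{graph}(u)=\{(x,u(x)):x\in A\}\subset A\times(-2T,2T)$, with the Riemannian metric induced by $g$ and its volume measure $\mu$. Let $\omega\in L(n/2,\infty)(M,g)$ and $V\in L^\infty(M)$ be real-valued functions with $\|\omega\|_{(n/2,\infty)}\le W$, $\operatorname{ess\,inf}\omega>0$, and $|V|\le\varepsilon\,\omega$ almost everywhere on $M$.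 Then $$0<\frac1{C\,W}\le\inf\Big\{\int_M\big(|\nabla f|^2-Vf^2\big)\,d\mu\;:\;f\in W^{1,2}_0(M),\ \int_M f^2\omega\,d\mu=1\Big\}.$$ Here, for a $\mu$-measurable function $h$ on $M$, $$\|h\|_{(n/2,\infty)}=\sup_{t>0}t^{2/n}h^*(t),\qquad h^*(t)=\inf\{s>0:\mu(\{|h|>s\})\le t\},$$ and $L(n/2,\infty)(M,g)$ is the set of those $h$ for which this quantity is finite. The gradient $\nabla f$ and its length $|\nabla f|$ are the (weak) gradient on $M$ and its length with respect to the induced metric, and $W^{1,2}_0(M)$ is the closure of $C^1_c(M)$ in $W^{1,2}(M)$ with respect to the norm $\big(\int_M f^2+|\nabla f|^2\,d\mu\big)^{1/2}$. -/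

import Mathlib

open MeasureTheory
open scoped ENNReal NNReal

namespace NeckStability

/-! ### The decreasing rearrangement and the space `L(p, ∞)` -/

section Lorentz

variable {X : Type*} [MeasurableSpace X]

/-- Distribution function `α_f(s) = μ {x : |f x| > s}`. -/
noncomputable def distribution (μ : Measure X) (f : X → ℝ) (s : ℝ≥0∞) : ℝ≥0∞ :=
  μ {x | s < ‖f x‖ₑ}

/-- Decreasing rearrangement `f^*(t) = inf {s > 0 : α_f(s) ≤ t}` for `t > 0`
(with value `∞` if no finite `s` is admissible). -/
noncomputable def rearrangement (μ : Measure X) (f : X → ℝ) (t : ℝ≥0) : ℝ≥0∞ :=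
  sInf {s : ℝ≥0∞ | 0 < s ∧ distribution μ f s ≤ t}

/-- `‖f‖_{(p, ∞)} = sup_{t > 0} t^{1/p} f^*(t)`. -/
noncomputable def lorentzNorm (μ : Measure X) (p : ℝ) (f : X → ℝ) : ℝ≥0∞ :=
  ⨆ (t : ℝ≥0) (_ : 0 < t), (t : ℝ≥0∞) ^ (1 / p) * rearrangement μ f t

/-- `f ∈ L(p, ∞)`. -/
def MemLorentz (μ : Measure X) (p : ℝ) (f : X → ℝ) : Prop :=
  AEStronglyMeasurable f μ ∧ lorentzNorm μ p f < ∞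

end Lorentz

/-! ### Riemannian metrics on open subsets of a vector space -/

/-- A smooth Riemannian metric on an (open) subset `Ω` of a normed space; the values of `form`
outside `Ω` are irrelevant. -/
structure RiemannianMetricOn {E : Type*} [NormedAddCommGroup E] [NormedSpace ℝ E]
    (Ω : Set E) where
  form : E → E →L[ℝ] E →L[ℝ] ℝ
  smooth : ContDiffOn ℝ (⊤ : ℕ∞) form Ω
  symm : ∀ p ∈ Ω, ∀ X Y, form p X Y = form p Y X
  pos : ∀ p ∈ Ω, ∀ X, X ≠ 0 → 0 < form p X X

/-! ### Cylinders and graphs -/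

/-- `ℝⁿ` with its Euclidean norm. -/
abbrev Base (n : ℕ) : Type := EuclideanSpace ℝ (Fin n)

/-- `ℝⁿ⁺¹ = ℝⁿ × ℝ`. Only its vector space structure, topology and smooth structure are used;
its Euclidean inner product is `euclideanSq` (the product norm of Mathlib is not used). -/
abbrev Ambient (n : ℕ) : Type := Base n × ℝ

variable {n : ℕ}

/-- The square `⟨X, X⟩` of the Euclidean norm of a vector `X` of `ℝⁿ⁺¹ = ℝⁿ × ℝ`. -/
noncomputable def euclideanSq (X : Ambient n) : ℝ := inner ℝ X.1 X.1 + X.2 ^ 2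

/-- The cylinder `A × ℝ`. -/
def cylinderOver (A : Set (Base n)) : Set (Ambient n) := {p | p.1 ∈ A}

/-- `F(x) = (x, u(x))`. -/
def graphMap (u : Base n → ℝ) (x : Base n) : Ambient n := (x, u x)

/-- The hypersurface `M = graph(u)` over `A`. -/
def graph (A : Set (Base n)) (u : Base n → ℝ) : Set (Ambient n) := graphMap u '' A

/-- The tangent space of the graph of `u` at its point `p` (which lies over `p.1`). -/
noncomputable def graphTangent (u : Base n → ℝ) (p : Ambient n) : Submodule ℝ (Ambient n) :=
  LinearMap.range (fderiv ℝ (graphMap u) p.1 : Base n →ₗ[ℝ] Ambient n)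

/-- Matrix, in the chart `F`, of the metric that `g` induces on the graph of `u`. -/
noncomputable def gram {A : Set (Base n)} (g : RiemannianMetricOn (cylinderOver A))
    (u : Base n → ℝ) (x : Base n) : Matrix (Fin n) (Fin n) ℝ :=
  Matrix.of fun i j => g.form (graphMap u x)
    (fderiv ℝ (graphMap u) x (EuclideanSpace.single i 1))
    (fderiv ℝ (graphMap u) x (EuclideanSpace.single j 1))

/-- The Riemannian volume measure of `M = graph(u)` with the metric induced by `g`: it is
`√(det g_ij) dx` in the global chart `F : A → M`. It is a measure on the ambient space carried
by `M`. -/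
noncomputable def graphVolume {A : Set (Base n)} (g : RiemannianMetricOn (cylinderOver A))
    (u : Base n → ℝ) : Measure (Ambient n) :=
  (((volume : Measure (Base n)).restrict A).withDensity
    fun x => ENNReal.ofReal (Real.sqrt (gram g u x).det)).map (graphMap u)

/-! ### Sobolev functions on the graph

Functions and vector fields on `M` are given by (arbitrary extensions to) maps on the ambient
space: only their values on `M`, resp. their classes modulo `graphVolume`, matter. -/

/-- `φ ∈ C¹_c(M)`. -/
def IsC1c (A : Set (Base n)) (u : Base n → ℝ) (φ : Ambient n → ℝ) : Prop :=
  ContDiffOn ℝ 1 (fun x => φ (graphMap u x)) A ∧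
    ∃ S : Set (Ambient n), IsCompact S ∧ S ⊆ graph A u ∧ ∀ p ∈ graph A u, p ∉ S → φ p = 0

/-- `Y` is the gradient on `M` of the `C¹` function `φ`: it is tangent to `M`, and
`g(Y, X) = dφ(X)` for the tangent vectors `X = dF(v)` of `M`. -/
def IsGradient {A : Set (Base n)} (g : RiemannianMetricOn (cylinderOver A)) (u : Base n → ℝ)
    (φ : Ambient n → ℝ) (Y : Ambient n → Ambient n) : Prop :=
  ∀ x ∈ A, Y (graphMap u x) ∈ graphTangent u (graphMap u x) ∧
    ∀ v : Base n, g.form (graphMap u x) (Y (graphMap u x)) (fderiv ℝ (graphMap u) x v) =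
      fderiv ℝ (fun y => φ (graphMap u y)) x v

/-- `Z` is the weak gradient on `M` of `f`: it is tangent to `M` almost everywhere, and the
one-form `X ↦ g(Z, X)` is the weak differential of `f`, that is, in the chart `F`,
`∫_A (f ∘ F) ∂_v ψ dx = - ∫_A g(Z ∘ F, dF(v)) ψ dx` for `ψ ∈ C_c^∞(A)` and `v ∈ ℝⁿ`. -/
def IsWeakGradient {A : Set (Base n)} (g : RiemannianMetricOn (cylinderOver A)) (u : Base n → ℝ)
    (f : Ambient n → ℝ) (Z : Ambient n → Ambient n) : Prop :=
  (∀ᵐ p ∂graphVolume g u, Z p ∈ graphTangent u p) ∧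
    ∀ ψ : Base n → ℝ, ContDiff ℝ (⊤ : ℕ∞) ψ → HasCompactSupport ψ → tsupport ψ ⊆ A →
      ∀ v : Base n,
        ∫ x in A, f (graphMap u x) * fderiv ℝ ψ x v =
          -∫ x in A, g.form (graphMap u x) (Z (graphMap u x))
            (fderiv ℝ (graphMap u) x v) * ψ x

/-- The squared norm `∫_M f² + |Z|²` of `W^{1,2}(M)`, for a function `f` with gradient `Z`. -/
noncomputable def sobolevNormSq {A : Set (Base n)} (g : RiemannianMetricOn (cylinderOver A))
    (u : Base n → ℝ) (f : Ambient n → ℝ) (Z : Ambient n → Ambient n) : ℝ≥0∞ :=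
  ∫⁻ p, ENNReal.ofReal (f p ^ 2 + g.form p (Z p) (Z p)) ∂graphVolume g u

/-- `f ∈ W^{1,2}(M)`, with weak gradient `∇f = Z`. -/
structure IsW12 {A : Set (Base n)} (g : RiemannianMetricOn (cylinderOver A)) (u : Base n → ℝ)
    (f : Ambient n → ℝ) (Z : Ambient n → Ambient n) : Prop where
  measurable : AEStronglyMeasurable f (graphVolume g u)
  measurable_grad : AEStronglyMeasurable Z (graphVolume g u)
  finite : sobolevNormSq g u f Z < ∞
  weakGradient : IsWeakGradient g u f Z

/-- `f ∈ W^{1,2}_0(M)`, the closure of `C¹_c(M)` in `W^{1,2}(M)`, with weak gradient `∇f = Z`. -/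
def IsW012 {A : Set (Base n)} (g : RiemannianMetricOn (cylinderOver A)) (u : Base n → ℝ)
    (f : Ambient n → ℝ) (Z : Ambient n → Ambient n) : Prop :=
  IsW12 g u f Z ∧ ∀ δ : ℝ≥0∞, 0 < δ → ∃ (φ : Ambient n → ℝ) (Y : Ambient n → Ambient n),
    IsC1c A u φ ∧ IsGradient g u φ Y ∧
      sobolevNormSq g u (fun p => f p - φ p) (fun p => Z p - Y p) < δ

/-- The set of values `∫_M |∇f|² - V f²` for `f ∈ W^{1,2}_0(M)` with `∫_M f² ω = 1`. -/
def energies {A : Set (Base n)} (g : RiemannianMetricOn (cylinderOver A)) (u : Base n → ℝ)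
    (ω V : Ambient n → ℝ) : Set ℝ :=
  {r | ∃ (f : Ambient n → ℝ) (Z : Ambient n → Ambient n), IsW012 g u f Z ∧
    ∫ p, f p ^ 2 * ω p ∂graphVolume g u = 1 ∧
    r = ∫ p, (g.form p (Z p) (Z p) - V p * f p ^ 2) ∂graphVolume g u}

end NeckStability

open NeckStability

/-! Everything rests on a Hardy-type inequality: `∫ f² ω ≤ C₁ W ∫ |∇f|²` for `f` in `W^{1,2}_0(M)`,
with `C₁` depending only on `n` and `K` (`exists_weighted_sobolev_W012`). Under `∫ f² ω = 1` it
gives `∫ |∇f|² ≥ 1/(C₁ W)`, while `|V| ≤ ε ω` gives `∫ V f² ≤ ε`. With `ε = 1/(2 C₁ W)` half of the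
lower bound survives.

Since `ω` is only in weak `L^{n/2}`, Hölder's inequality against the `L^{2n/(n-2)}` Sobolev
inequality does not suffice. The weak norm enters instead as `∫_E |ω| ≤ c W μ(E)^{1-2/n}`
(`setLIntegral_le_of_lorentzNorm_le`), combined with truncation at dyadic levels: Sobolev for a
truncation of `h` bounds the measure of `{|h| > 2^{k+1}}` by the energy of `h` on the shell `{2^k <
|h| ≤ 2^{k+1}}` alone (`exists_sobolev_levelset`). The shells are disjoint, so the estimates sum to
the full energy (`exists_weighted_sobolev`).

This argument lives in `ℝⁿ`. The bounds on `g` and on the slope of `u` make the induced metric and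
volume comparable with the Euclidean ones in the chart `F`, with constants depending on `n` and `K`
(`exists_weighted_sobolev_C1c`); Fatou's lemma then passes from `C¹_c` to its closure.

The constraint set must also be shown nonempty, because the real infimum of the empty set is `0`. A
normalised bump function lies in it, its gradient being written with the inverse Gram matrix. -/

namespace NeckStability

/-! ### Integrals of weak `L^p` functions over sets. -/

section Lorentz

variable {X : Type*} [MeasurableSpace X]

/-- A function in weak `L^p` satisfies Chebyshev's inequality with its Lorentz norm. -/
theorem distribution_le_of_lorentzNorm_le {μ : Measure X} {p W s : ℝ} {f : X → ℝ} (hp : 0 < p)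
    (hW : 0 < W) (hs : 0 < s) (hf : lorentzNorm μ p f ≤ ENNReal.ofReal W) :
    distribution μ f (ENNReal.ofReal s) ≤ ENNReal.ofReal ((W / s) ^ p) := by
  refine ENNReal.le_of_forall_nnreal_lt fun t ht => ?_
  rcases eq_or_lt_of_le (zero_le (a := t)) with rfl | ht0
  · simp
  -- The distribution function is antitone: an admissible level below `s` would force its value at
  -- `s` to be at most `t`, against `ht`.
  have h1 : ENNReal.ofReal s ≤ rearrangement μ f t := by
    refine le_sInf fun s' hs' => ?_
    by_contra! hlt
    refine absurd (lt_of_lt_of_le ht (le_trans ?_ hs'.2)) (lt_irrefl _)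
    exact measure_mono fun x hx => lt_trans hlt hx
  have h2 : (t : ℝ≥0∞) ^ (1 / p) * ENNReal.ofReal s ≤ ENNReal.ofReal W :=
    le_trans (mul_le_mul_right h1 _)
      (le_trans (le_iSup₂ (f := fun (t : ℝ≥0) (_ : 0 < t) =>
        (t : ℝ≥0∞) ^ (1 / p) * rearrangement μ f t) t ht0) hf)
  have h3 : (t : ℝ) ^ (1 / p) * s ≤ W := by
    rw [← ENNReal.ofReal_coe_nnreal, ENNReal.ofReal_rpow_of_nonneg t.coe_nonneg (by positivity),
      ← ENNReal.ofReal_mul (by positivity)] at h2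
    exact (ENNReal.ofReal_le_ofReal_iff hW.le).1 h2
  have h4 : (t : ℝ) ≤ (W / s) ^ p := by
    have := Real.rpow_le_rpow (by positivity) ((le_div_iff₀ hs).2 h3) hp.le
    rwa [← Real.rpow_mul t.coe_nonneg, one_div, inv_mul_cancel₀ hp.ne', Real.rpow_one] at this
  rw [← ENNReal.ofReal_coe_nnreal]
  exact ENNReal.ofReal_le_ofReal h4

/-- The integral of a weak `L^p` function over a set of finite measure. -/
theorem setLIntegral_le_of_lorentzNorm_le {μ : Measure X} {p W : ℝ} {f : X → ℝ} (hp : 1 < p)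
    (hW : 0 < W) (hfm : AEStronglyMeasurable f μ) (hf : lorentzNorm μ p f ≤ ENNReal.ofReal W)
    (E : Set X) :
    ∫⁻ x in E, ‖f x‖ₑ ∂μ ≤ ENNReal.ofReal (p / (p - 1) * W) * μ E ^ (1 - 1 / p) := by
  have hp0 : 0 < p := by linarith
  have hexp : 0 < 1 - 1 / p := by rw [sub_pos, div_lt_one hp0]; exact hp
  have hc : 0 < p / (p - 1) * W := mul_pos (div_pos hp0 (by linarith)) hW
  rcases eq_or_ne (μ E) 0 with h0 | h0
  · rw [Measure.restrict_eq_zero.2 h0]; simp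
  rcases eq_or_ne (μ E) ∞ with ht | ht
  · rw [ht, ENNReal.top_rpow_of_pos hexp, ENNReal.mul_top (by simpa using hc)]; exact le_top
  set m := (μ E).toReal with hm
  have hm0 : 0 < m := ENNReal.toReal_pos h0 ht
  have hmE : μ E = ENNReal.ofReal m := (ENNReal.ofReal_toReal ht).symm
  -- The level at which the Chebyshev bound `(W / s) ^ p` equals `m = μ E`. In the layer-cake
  -- integral, `m` is used below it and Chebyshev above it.
  set s₀ := W * m ^ (-(1 / p)) with hs₀
  have hs₀pos : 0 < s₀ := by positivity
  have hlayer : ∫⁻ x in E, ‖f x‖ₑ ∂μ = ∫⁻ t in Set.Ioi (0 : ℝ), (μ.restrict E) {a | t < |f a|} := by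
    rw [← lintegral_eq_lintegral_meas_lt (μ.restrict E) (Filter.Eventually.of_forall fun x =>
      abs_nonneg (f x)) hfm.restrict.aemeasurable.abs]
    simp_rw [Real.enorm_eq_ofReal_abs]
  have hlow : ∫⁻ t in Set.Ioc 0 s₀, (μ.restrict E) {a | t < |f a|} ≤ ENNReal.ofReal (s₀ * m) := by
    calc _ ≤ ∫⁻ t in Set.Ioc 0 s₀, μ E := lintegral_mono fun t => by
            simpa using measure_mono (μ := μ.restrict E) (Set.subset_univ {a | t < |f a|})
      _ = _ := by
            rw [setLIntegral_const, hmE, Real.volume_Ioc, sub_zero, ← ENNReal.ofReal_mul hm0.le,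
              mul_comm]
  have hhigh : ∫⁻ t in Set.Ioi s₀, (μ.restrict E) {a | t < |f a|} ≤
      ENNReal.ofReal (W ^ p * (s₀ ^ (1 - p) / (p - 1))) := by
    have hint : IntegrableOn (fun t : ℝ => W ^ p * t ^ (-p)) (Set.Ioi s₀) :=
      (integrableOn_Ioi_rpow_of_lt (by linarith) hs₀pos).const_mul _
    calc _ ≤ ∫⁻ t in Set.Ioi s₀, ENNReal.ofReal (W ^ p * t ^ (-p)) := by
            refine setLIntegral_mono' measurableSet_Ioi fun t ht => ?_
            have ht0 : 0 < t := hs₀pos.trans ht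
            refine le_trans (Measure.restrict_apply_le _ _) ?_
            have := distribution_le_of_lorentzNorm_le hp0 hW ht0 hf
            rw [Real.div_rpow hW.le ht0.le, div_eq_mul_inv, ← Real.rpow_neg ht0.le] at this
            refine le_trans (measure_mono fun a ha => ?_) this
            have ha' : t < |f a| := ha
            change _ < ‖f a‖ₑ
            rw [Real.enorm_eq_ofReal_abs]
            exact (ENNReal.ofReal_lt_ofReal_iff (ht0.trans ha')).2 ha'
      _ = ENNReal.ofReal (∫ t in Set.Ioi s₀, W ^ p * t ^ (-p)) := by
            rw [ofReal_integral_eq_lintegral_ofReal hint]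
            filter_upwards [ae_restrict_mem measurableSet_Ioi] with t ht
            have : 0 < t := hs₀pos.trans ht
            positivity
      _ = _ := by
            rw [integral_const_mul, integral_Ioi_rpow_of_lt (by linarith) hs₀pos]
            congr 2
            rw [show -p + 1 = 1 - p by ring, ← neg_sub p 1, div_neg, neg_div, neg_neg]
  have hsm : s₀ * m = W * m ^ (1 - 1 / p) := by
    rw [hs₀, mul_assoc, sub_eq_neg_add, Real.rpow_add hm0, Real.rpow_one]
  have hsp : W ^ p * s₀ ^ (1 - p) = W * m ^ (1 - 1 / p) := by
    rw [hs₀, Real.mul_rpow hW.le (by positivity), ← Real.rpow_mul hm0.le, ← mul_assoc,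
      ← Real.rpow_add hW, add_sub_cancel, Real.rpow_one]
    congr 2
    field_simp
    ring
  have hp1 : p - 1 ≠ 0 := by linarith
  have hsplit : Set.Ioi (0 : ℝ) = Set.Ioc 0 s₀ ∪ Set.Ioi s₀ :=
    (Set.Ioc_union_Ioi_eq_Ioi hs₀pos.le).symm
  calc ∫⁻ x in E, ‖f x‖ₑ ∂μ
      ≤ ENNReal.ofReal (s₀ * m) + ENNReal.ofReal (W ^ p * (s₀ ^ (1 - p) / (p - 1))) := by
        rw [hlayer, hsplit]
        exact (lintegral_union_le _ _ _).trans (add_le_add hlow hhigh)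
    _ = ENNReal.ofReal (p / (p - 1) * W * m ^ (1 - 1 / p)) := by
        have h2 : 0 ≤ W ^ p * (s₀ ^ (1 - p) / (p - 1)) :=
          mul_nonneg (by positivity) (div_nonneg (by positivity) (by linarith))
        rw [← ENNReal.ofReal_add (by positivity) h2, hsm, ← mul_div_assoc, hsp]
        congr 1
        field_simp
        ring
    _ = _ := by
        rw [hmE, ENNReal.ofReal_rpow_of_pos hm0, ← ENNReal.ofReal_mul hc.le]

end Lorentz
end NeckStability

/-! ### The weighted Sobolev inequality in `ℝⁿ`. -/

namespace NeckStability

/-- A `C¹` cutoff which vanishes on `[-1, 1]` and is `1` off `(-2, 2)`. -/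
theorem exists_smooth_cutoff : ∃ (ψ : ℝ → ℝ) (L : ℝ≥0), ContDiff ℝ 1 ψ ∧
    (∀ t, |t| ≤ 1 → ψ t = 0) ∧ (∀ t, 2 ≤ |t| → ψ t = 1) ∧ (∀ t, ‖deriv ψ t‖ ≤ L) ∧
    ∀ t, |t| ≤ 1 ∨ 2 < |t| → deriv ψ t = 0 := by
  set ψ : ℝ → ℝ := fun t => Real.smoothTransition ((t ^ 2 - 1) / 3) with hψ
  have hC : ContDiff ℝ 1 ψ := Real.smoothTransition.contDiff.comp (by fun_prop)
  have h0 : ∀ t, |t| ≤ 1 → ψ t = 0 := fun t ht =>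
    Real.smoothTransition.zero_of_nonpos (by nlinarith [sq_abs t, abs_nonneg t])
  have h1 : ∀ t, 2 ≤ |t| → ψ t = 1 := fun t ht =>
    Real.smoothTransition.one_of_one_le (by nlinarith [sq_abs t, abs_nonneg t])
  -- `ψ` takes values in `[0, 1]`, so it has a minimum wherever it is `0` and a maximum wherever it
  -- is `1`; this includes the endpoints `|t| = 1`. What remains, `1 < |t| ≤ 2`, matches the
  -- half-open dyadic shells that are summed later.
  have hd : ∀ t, |t| ≤ 1 ∨ 2 < |t| → deriv ψ t = 0 := by
    rintro t (ht | ht)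
    · refine IsLocalMin.deriv_eq_zero (Filter.Eventually.of_forall fun s => ?_)
      rw [h0 t ht]
      exact Real.smoothTransition.nonneg _
    · refine IsLocalMax.deriv_eq_zero (Filter.Eventually.of_forall fun s => ?_)
      rw [h1 t ht.le]
      exact Real.smoothTransition.le_one _
  have hsupp : HasCompactSupport (deriv ψ) := by
    refine HasCompactSupport.intro (isCompact_Icc (a := (-2 : ℝ)) (b := 2)) fun t ht => hd t ?_
    right
    by_contra! h
    exact ht (abs_le.1 h)
  obtain ⟨L, hL⟩ := (hC.continuous_deriv le_rfl).bounded_above_of_compact_support hsupp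
  exact ⟨ψ, L.toNNReal, hC, h0, h1, fun t => (hL t).trans (Real.le_coe_toNNReal _), hd⟩

/-- A level-set form of the Sobolev inequality. -/
theorem exists_sobolev_levelset (n : ℕ) (hn : 3 ≤ n) : ∃ C : ℝ≥0, ∀ h : Base n → ℝ,
    ContDiff ℝ 1 h → HasCompactSupport h → ∀ l : ℝ, 0 < l →
      ENNReal.ofReal l ^ 2 * volume {x | 2 * l < |h x|} ^ (1 - 2 / (n : ℝ)) ≤
        C * ∫⁻ x in {x | |h x| ∈ Set.Ioc l (2 * l)}, ‖fderiv ℝ h x‖ₑ ^ 2 := by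
  obtain ⟨ψ, L, hC, h0, h1, hL, hd⟩ := exists_smooth_cutoff
  have hn' : (3 : ℝ) ≤ n := by exact_mod_cast hn
  set q : ℝ≥0 := ⟨2 * n / (n - 2), div_nonneg (by positivity) (by linarith)⟩ with hq
  have hqv : (q : ℝ) = 2 * n / (n - 2) := rfl
  have hq0 : 0 < (q : ℝ) := by rw [hqv]; exact div_pos (by linarith) (by linarith)
  set S := eLpNormLESNormFDerivOfEqInnerConst (volume : Measure (Base n)) 2
  refine ⟨(S * L) ^ 2, fun h hh hs l hl => ?_⟩
  set D := {x | |h x| ∈ Set.Ioc l (2 * l)} with hD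
  have hDm : MeasurableSet D := (hh.continuous.abs.measurable) measurableSet_Ioc
  have hψ0 : ψ 0 = 0 := h0 0 (by simp)
  -- The truncation of `h`: it is `1` where `|h| > 2l`, and its gradient lives on the shell `D` with
  -- size at most `L / l` times that of `h`.
  set f : Base n → ℝ := fun x => ψ (l⁻¹ * h x) with hf
  have hfC : ContDiff ℝ 1 f := hC.comp (contDiff_const.mul hh)
  have hfs : HasCompactSupport f := hs.comp_left (g := fun t => ψ (l⁻¹ * t)) (by simp [hψ0])
  have hfd : ∀ x, ‖fderiv ℝ f x‖ₑ ≤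
      D.indicator (fun x => (L : ℝ≥0∞) * (ENNReal.ofReal l)⁻¹ * ‖fderiv ℝ h x‖ₑ) x := by
    intro x
    have hhd : DifferentiableAt ℝ h x := hh.differentiable one_ne_zero x
    have hder : fderiv ℝ f x = deriv ψ (l⁻¹ * h x) • (l⁻¹ • fderiv ℝ h x) := by
      have h2 : HasFDerivAt (fun x => l⁻¹ * h x) (l⁻¹ • fderiv ℝ h x) x :=
        hhd.hasFDerivAt.const_mul _
      exact ((hC.differentiable one_ne_zero _).hasDerivAt.comp_hasFDerivAt x h2).fderiv
    have habs : |l⁻¹ * h x| = |h x| / l := by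
      rw [abs_mul, abs_of_pos (inv_pos.2 hl), inv_mul_eq_div]
    by_cases hx : x ∈ D
    · rw [Set.indicator_of_mem hx, hder, enorm_smul, enorm_smul, ← mul_assoc]
      gcongr
      · rw [← ofReal_norm, ← ENNReal.ofReal_coe_nnreal]
        exact ENNReal.ofReal_le_ofReal (hL _)
      · rw [Real.enorm_eq_ofReal (by positivity), ENNReal.ofReal_inv_of_pos hl]
    · have hz : deriv ψ (l⁻¹ * h x) = 0 := by
        apply hd
        rw [habs, div_le_one hl, lt_div_iff₀ hl]
        by_contra! hc
        exact hx ⟨hc.1, hc.2⟩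
      rw [hder, hz, zero_smul]
      exact (enorm_zero (E := Base n →L[ℝ] ℝ)).le.trans zero_le
  have hsob := eLpNorm_le_eLpNorm_fderiv_of_eq_inner (volume : Measure (Base n)) hfC hfs
    (p := 2) (p' := q) (by norm_num) (by simp; omega) (by
      rw [hqv]; simp only [finrank_euclideanSpace, Fintype.card_fin]; push_cast
      have : (n : ℝ) - 2 ≠ 0 := by linarith
      field_simp)
  have hleft : volume {x | 2 * l < |h x|} ^ (1 / (q : ℝ)) ≤ eLpNorm f q volume := by
    have hm : MeasurableSet {x | 2 * l < |h x|} :=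
      measurableSet_lt measurable_const hh.continuous.abs.measurable
    rw [eLpNorm_eq_lintegral_rpow_enorm_toReal (by simpa using hq0.ne') ENNReal.coe_ne_top]
    simp only [ENNReal.coe_toReal]
    gcongr
    calc volume {x | 2 * l < |h x|} = ∫⁻ x in {x | 2 * l < |h x|}, 1 := by simp
      _ ≤ ∫⁻ x in {x | 2 * l < |h x|}, ‖f x‖ₑ ^ (q : ℝ) := by
          refine setLIntegral_mono' hm fun x hx => ?_
          have : f x = 1 := h1 _ (by
            rw [abs_mul, abs_of_pos (inv_pos.2 hl), inv_mul_eq_div, le_div_iff₀ hl]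
            exact le_of_lt hx)
          simp [this]
      _ ≤ _ := setLIntegral_le_lintegral _ _
  have hright : eLpNorm (fderiv ℝ f) (2 : ℝ≥0) volume ^ 2 ≤
      ((L : ℝ≥0∞) * (ENNReal.ofReal l)⁻¹) ^ 2 * ∫⁻ x in D, ‖fderiv ℝ h x‖ₑ ^ 2 := by
    have := eLpNorm_nnreal_pow_eq_lintegral (μ := (volume : Measure (Base n)))
      (f := fderiv ℝ f) (p := 2) two_ne_zero
    simp only [NNReal.coe_ofNat, ENNReal.rpow_ofNat] at this
    rw [this, ← lintegral_const_mul' _ _ (by finiteness), ← lintegral_indicator hDm]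
    refine lintegral_mono fun x => ?_
    refine (pow_le_pow_left₀ zero_le (hfd x) 2).trans (le_of_eq ?_)
    by_cases hx : x ∈ D <;> simp [hx, mul_pow]
  have hexp : (1 - 2 / (n : ℝ)) = 1 / (q : ℝ) * (2 : ℕ) := by
    rw [hqv]; push_cast
    have : (n : ℝ) - 2 ≠ 0 := by linarith
    field_simp
  have hl0 : ENNReal.ofReal l ≠ 0 := by simpa using hl
  calc _ = ENNReal.ofReal l ^ 2 * (volume {x | 2 * l < |h x|} ^ (1 / (q : ℝ))) ^ 2 := by
        rw [hexp, ENNReal.rpow_mul, ENNReal.rpow_natCast]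
    _ ≤ ENNReal.ofReal l ^ 2 * (S * eLpNorm (fderiv ℝ f) (2 : ℝ≥0) volume) ^ 2 := by
        gcongr; exact hleft.trans hsob
    _ ≤ ENNReal.ofReal l ^ 2 * (S ^ 2 *
          (((L : ℝ≥0∞) * (ENNReal.ofReal l)⁻¹) ^ 2 * ∫⁻ x in D, ‖fderiv ℝ h x‖ₑ ^ 2)) := by
        rw [mul_pow]; gcongr
    _ = (ENNReal.ofReal l * (ENNReal.ofReal l)⁻¹) ^ 2 *
          ((((S * L) ^ 2 : ℝ≥0) : ℝ≥0∞) * ∫⁻ x in D, ‖fderiv ℝ h x‖ₑ ^ 2) := by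
        push_cast; ring
    _ = _ := by rw [ENNReal.mul_inv_cancel hl0 ENNReal.ofReal_ne_top, one_pow, one_mul]

/-- Weighted Sobolev (Hardy-type) inequality for a weight in weak `L^{n/2}`. -/
theorem exists_weighted_sobolev (n : ℕ) (hn : 3 ≤ n) : ∃ C : ℝ≥0, ∀ h : Base n → ℝ,
    ContDiff ℝ 1 h → HasCompactSupport h → ∀ (w : Base n → ℝ≥0∞) (B : ℝ≥0∞),
      (∀ E, MeasurableSet E → ∫⁻ x in E, w x ≤ B * volume E ^ (1 - 2 / (n : ℝ))) →
      ∫⁻ x, ‖h x‖ₑ ^ 2 * w x ≤ C * B * ∫⁻ x, ‖fderiv ℝ h x‖ₑ ^ 2 := by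
  obtain ⟨C, hC⟩ := exists_sobolev_levelset n hn
  refine ⟨16 * C, fun h hh hs w B hw => ?_⟩
  set D : ℤ → Set (Base n) := fun k => {x | |h x| ∈ Set.Ioc ((2 : ℝ) ^ k) (2 ^ (k + 1))} with hD
  have hDm : ∀ k, MeasurableSet (D k) := fun k => hh.continuous.abs.measurable measurableSet_Ioc
  have hDd : Pairwise (Function.onFun Disjoint D) := by
    have hm : Monotone fun k : ℤ => (2 : ℝ) ^ k := zpow_right_mono₀ one_le_two
    intro i j hij
    exact (hm.pairwise_disjoint_on_Ioc_succ hij).preimage (fun x => |h x|)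
  -- The weighted mass on shell `k + 1` is paid for by the energy on shell `k`. There `|h| ≤ 4l`
  -- with `l = 2 ^ k`, whence the factor `16`.
  have hterm : ∀ k : ℤ, ∫⁻ x in D (k + 1), ‖h x‖ₑ ^ 2 * w x ≤
      16 * C * B * ∫⁻ x in D k, ‖fderiv ℝ h x‖ₑ ^ 2 := by
    intro k
    set l : ℝ := 2 ^ k with hl
    have hl0 : 0 < l := by positivity
    have hl1 : (2 : ℝ) ^ (k + 1) = 2 * l := by rw [zpow_add_one₀ two_ne_zero, mul_comm]
    have hl2 : (2 : ℝ) ^ (k + 1 + 1) = 4 * l := by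
      rw [zpow_add_one₀ two_ne_zero, hl1]; ring
    have hk := hC h hh hs l hl0
    have hDk : D k = {x | |h x| ∈ Set.Ioc l (2 * l)} := by simp only [hD, hl1]; rfl
    rw [hDk]
    calc ∫⁻ x in D (k + 1), ‖h x‖ₑ ^ 2 * w x
        ≤ ∫⁻ x in D (k + 1), (16 * ENNReal.ofReal l ^ 2) * w x := by
          refine setLIntegral_mono' (hDm _) fun x hx => ?_
          have hx2 : |h x| ≤ 4 * l := hl2 ▸ hx.2
          gcongr
          calc ‖h x‖ₑ ^ 2 ≤ (ENNReal.ofReal (4 * l)) ^ 2 := by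
                rw [Real.enorm_eq_ofReal_abs]; gcongr
            _ = _ := by
                rw [ENNReal.ofReal_mul (by norm_num), mul_pow]; norm_num
      _ = (16 * ENNReal.ofReal l ^ 2) * ∫⁻ x in D (k + 1), w x :=
          lintegral_const_mul' _ _ (by finiteness)
      _ ≤ (16 * ENNReal.ofReal l ^ 2) *
            (B * volume {x | 2 * l < |h x|} ^ (1 - 2 / (n : ℝ))) := by
          gcongr
          refine (hw _ (hDm _)).trans ?_
          have : 0 ≤ 1 - 2 / (n : ℝ) := by
            have : (3 : ℝ) ≤ n := by exact_mod_cast hn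
            rw [sub_nonneg, div_le_one (by linarith)]; linarith
          gcongr
          intro x hx
          exact hl1 ▸ hx.1
      _ = 16 * B * (ENNReal.ofReal l ^ 2 * volume {x | 2 * l < |h x|} ^ (1 - 2 / (n : ℝ))) := by
          ring
      _ ≤ 16 * B * (C * ∫⁻ x in {x | |h x| ∈ Set.Ioc l (2 * l)}, ‖fderiv ℝ h x‖ₑ ^ 2) := by
          gcongr
      _ = _ := by ring
  have hcover : ∀ x, x ∉ ⋃ k, D k → h x = 0 := by
    intro x hx
    by_contra h0
    obtain ⟨k, hk⟩ := exists_mem_Ioc_zpow (abs_pos.2 h0) (one_lt_two (α := ℝ))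
    exact hx (Set.mem_iUnion.2 ⟨k, hk⟩)
  calc ∫⁻ x, ‖h x‖ₑ ^ 2 * w x = ∫⁻ x in ⋃ k, D k, ‖h x‖ₑ ^ 2 * w x := by
        rw [← lintegral_indicator (MeasurableSet.iUnion hDm)]
        refine lintegral_congr fun x => ?_
        by_cases hx : x ∈ ⋃ k, D k
        · rw [Set.indicator_of_mem hx]
        · rw [Set.indicator_of_notMem hx, hcover x hx]; simp
    _ = ∑' k, ∫⁻ x in D k, ‖h x‖ₑ ^ 2 * w x := lintegral_iUnion hDm hDd _
    _ = ∑' k, ∫⁻ x in D (k + 1), ‖h x‖ₑ ^ 2 * w x :=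
        ((Equiv.addRight (1 : ℤ)).tsum_eq _).symm
    _ ≤ ∑' k, 16 * C * B * ∫⁻ x in D k, ‖fderiv ℝ h x‖ₑ ^ 2 := ENNReal.tsum_le_tsum hterm
    _ = 16 * C * B * ∫⁻ x in ⋃ k, D k, ‖fderiv ℝ h x‖ₑ ^ 2 := by
        rw [ENNReal.tsum_mul_left, lintegral_iUnion hDm hDd]
    _ ≤ _ := by
        push_cast
        gcongr
        exact Measure.restrict_le_self

end NeckStability

/-! ### The induced metric and its Gram matrix in the global chart. -/

namespace NeckStability

variable {n : ℕ}

/-- The standing assumptions on a cylinder metric and a graph of small slope. -/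
structure IsControlledGraph (K : ℝ) {A : Set (Base n)} (g : RiemannianMetricOn (cylinderOver A))
    (u : Base n → ℝ) : Prop where
  one_le : 1 ≤ K
  isOpen : IsOpen A
  bounds : ∀ p ∈ cylinderOver A, ∀ X : Ambient n,
    1 / K * euclideanSq X ≤ g.form p X X ∧ g.form p X X ≤ K * euclideanSq X
  smooth : ContDiffOn ℝ (⊤ : ℕ∞) u A
  slope : ∀ x ∈ A, ∀ v, |fderiv ℝ u x v| ≤ 1 / 2 * ‖v‖

/-- An essential bound on the gradient of a `C¹` function on an open set holds everywhere. -/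
theorem abs_fderiv_le_of_eLpNorm_gradient_le {A : Set (Base n)} {u : Base n → ℝ} (hA : IsOpen A)
    (hu : ContDiffOn ℝ (⊤ : ℕ∞) u A)
    (h : eLpNorm (gradient u) ∞ (volume.restrict A) ≤ 1 / 2) (x : Base n) (hx : x ∈ A)
    (v : Base n) : |fderiv ℝ u x v| ≤ 1 / 2 * ‖v‖ := by
  have hgr : ∀ y, ‖gradient u y‖ = ‖fderiv ℝ u y‖ := fun y => by
    rw [gradient, LinearIsometryEquiv.norm_map]
  have hcont : ContinuousOn (fun y => ‖fderiv ℝ u y‖) A :=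
    (hu.continuousOn_fderiv_of_isOpen hA (by simp)).norm
  have hae : ∀ᵐ y ∂volume.restrict A, ‖fderiv ℝ u y‖ ≤ 1 / 2 := by
    rw [eLpNorm_exponent_top] at h
    filter_upwards [ae_le_eLpNormEssSup (f := gradient u) (μ := volume.restrict A)] with y hy
    have := hy.trans h
    rw [← ofReal_norm, hgr, show (1 / 2 : ℝ≥0∞) = ENNReal.ofReal (1 / 2) by
      rw [ENNReal.ofReal_div_of_pos two_pos]; simp] at this
    exact (ENNReal.ofReal_le_ofReal_iff (by norm_num)).1 this
  have hle : ‖fderiv ℝ u x‖ ≤ 1 / 2 := by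
    by_contra! hlt
    -- By continuity the bad set is open; it is also null, so it cannot contain `x`.
    have hopen : IsOpen (A ∩ (fun y => ‖fderiv ℝ u y‖) ⁻¹' Set.Ioi (1 / 2)) :=
      hcont.isOpen_inter_preimage hA isOpen_Ioi
    have hpos := hopen.measure_pos volume ⟨x, hx, hlt⟩
    rw [ae_restrict_iff' hA.measurableSet] at hae
    refine hpos.ne' (measure_mono_null ?_ hae)
    rintro y ⟨hyA, hy⟩ hc
    exact absurd (hc hyA) (not_le.2 hy)
  exact ((fderiv ℝ u x).le_opNorm v).trans (by gcongr)

/-- A real symmetric matrix whose quadratic form lies between `a` and `b` has its determinant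
between `a ^ n` and `b ^ n`. -/
theorem _root_.Matrix.IsHermitian.det_mem_Icc_of_quadraticForm {G : Matrix (Fin n) (Fin n) ℝ}
    (hG : G.IsHermitian) {a b : ℝ} (ha : 0 ≤ a)
    (h : ∀ v : Base n, a * ‖v‖ ^ 2 ≤ v.ofLp ⬝ᵥ G.mulVec v.ofLp ∧
      v.ofLp ⬝ᵥ G.mulVec v.ofLp ≤ b * ‖v‖ ^ 2) :
    a ^ n ≤ G.det ∧ G.det ≤ b ^ n := by
  have hev : ∀ i, a ≤ hG.eigenvalues i ∧ hG.eigenvalues i ≤ b := by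
    intro i
    have := h (hG.eigenvectorBasis i)
    rw [hG.eigenvectorBasis.norm_eq_one] at this
    rw [hG.eigenvalues_eq]
    simpa using this
  rw [hG.det_eq_prod_eigenvalues]
  constructor
  · simpa using Finset.prod_le_prod (s := Finset.univ) (fun i _ => ha) (fun i _ => (hev i).1)
  · simpa using Finset.prod_le_prod (s := Finset.univ) (fun i _ => ha.trans (hev i).1)
      (fun i _ => (hev i).2)

section Chart

variable {A : Set (Base n)} {g : RiemannianMetricOn (cylinderOver A)} {u : Base n → ℝ}

theorem isOpen_cylinderOver (hA : IsOpen A) : IsOpen (cylinderOver A) :=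
  hA.preimage continuous_fst

theorem graphMap_mem_cylinderOver {x : Base n} (hx : x ∈ A) : graphMap u x ∈ cylinderOver A := hx

/-- Cauchy–Schwarz for a Riemannian metric. -/
theorem RiemannianMetricOn.form_sq_le {p : Ambient n} (hp : p ∈ cylinderOver A) (X Y : Ambient n) :
    g.form p X Y ^ 2 ≤ g.form p X X * g.form p Y Y := by
  have hnn : ∀ X, 0 ≤ g.form p X X := fun X => by
    rcases eq_or_ne X 0 with rfl | h
    · simp
    · exact (g.pos p hp X h).le
  have := discrim_le_zero (a := g.form p Y Y) (b := 2 * g.form p X Y) (c := g.form p X X)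
    fun t => by
      have := hnn (X + t • Y)
      simp only [map_add, map_smul, add_apply, smul_apply,
        smul_eq_mul, g.symm p hp Y X] at this
      linarith
  rw [discrim] at this
  linarith

theorem RiemannianMetricOn.form_self_nonneg {p : Ambient n} (hp : p ∈ cylinderOver A)
    (X : Ambient n) : 0 ≤ g.form p X X := by
  rcases eq_or_ne X 0 with rfl | h
  · simp
  · exact (g.pos p hp X h).le

/-- Links matrix algebra to the metric: it feeds both the determinant bounds and the formula for
gradients through the inverse Gram matrix. -/
theorem dotProduct_gram_mulVec (x v w : Base n) :
    v.ofLp ⬝ᵥ (gram g u x).mulVec w.ofLp =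
      g.form (graphMap u x) (fderiv ℝ (graphMap u) x v) (fderiv ℝ (graphMap u) x w) := by
  have hexp : ∀ v : Base n, v = ∑ i, v i • EuclideanSpace.single i (1 : ℝ) := fun v => by
    simpa using ((EuclideanSpace.basisFun (Fin n) ℝ).sum_repr v).symm
  conv_rhs => rw [hexp v, hexp w]
  simp only [map_sum, map_smul, sum_apply, smul_apply,
    dotProduct, Matrix.mulVec, gram, Matrix.of_apply, smul_eq_mul, Finset.mul_sum]
  rw [Finset.sum_comm]
  refine Finset.sum_congr rfl fun i _ => Finset.sum_congr rfl fun j _ => ?_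
  ring

theorem isHermitian_gram {x : Base n} (hx : x ∈ A) : (gram g u x).IsHermitian := by
  ext i j
  exact g.symm _ (graphMap_mem_cylinderOver hx) _ _

namespace IsControlledGraph

variable {K : ℝ} (H : IsControlledGraph K g u)
include H

theorem pos : 0 < K := by linarith [H.one_le]

theorem contDiffOn_graphMap : ContDiffOn ℝ (⊤ : ℕ∞) (graphMap u) A :=
  contDiffOn_id.prodMk H.smooth

theorem continuousOn_graphMap : ContinuousOn (graphMap u) A := H.contDiffOn_graphMap.continuousOn

theorem fderiv_graphMap {x : Base n} (hx : x ∈ A) (v : Base n) :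
    fderiv ℝ (graphMap u) x v = (v, fderiv ℝ u x v) := by
  have hd : DifferentiableAt ℝ u x :=
    (H.smooth.contDiffAt (H.isOpen.mem_nhds hx)).differentiableAt (by simp)
  have h : HasFDerivAt (graphMap u) ((ContinuousLinearMap.id ℝ (Base n)).prod (fderiv ℝ u x)) x :=
    (hasFDerivAt_id x).prodMk hd.hasFDerivAt
  rw [h.fderiv]; rfl

/-- The tangent vector is `(v, du(v))` with `du(v)² ≤ ‖v‖² / 4`, so its Euclidean square lies
between `‖v‖²` and `5/4 ‖v‖²`; the bounds on `g` supply the factors `1 / K` and `K`. -/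
theorem form_fderiv_bounds {x : Base n} (hx : x ∈ A) (v : Base n) :
    1 / K * ‖v‖ ^ 2 ≤ g.form (graphMap u x) (fderiv ℝ (graphMap u) x v)
      (fderiv ℝ (graphMap u) x v) ∧
    g.form (graphMap u x) (fderiv ℝ (graphMap u) x v) (fderiv ℝ (graphMap u) x v) ≤
      5 / 4 * K * ‖v‖ ^ 2 := by
  have hb := H.bounds _ (graphMap_mem_cylinderOver (u := u) hx) (fderiv ℝ (graphMap u) x v)
  have he : euclideanSq (fderiv ℝ (graphMap u) x v) = ‖v‖ ^ 2 + fderiv ℝ u x v ^ 2 := by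
    rw [H.fderiv_graphMap hx, euclideanSq, real_inner_self_eq_norm_sq]
  have hs := H.slope x hx v
  have hs2 : fderiv ℝ u x v ^ 2 ≤ 1 / 4 * ‖v‖ ^ 2 := by
    rw [← sq_abs]
    calc _ ≤ (1 / 2 * ‖v‖) ^ 2 := by gcongr
      _ = _ := by ring
  have hK := H.pos
  rw [he] at hb
  refine ⟨le_trans ?_ hb.1, hb.2.trans ?_⟩
  · gcongr; nlinarith [sq_nonneg (fderiv ℝ u x v)]
  · nlinarith

theorem det_gram_bounds {x : Base n} (hx : x ∈ A) :
    (1 / K) ^ n ≤ (gram g u x).det ∧ (gram g u x).det ≤ (5 / 4 * K) ^ n := by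
  have := H.pos
  refine (isHermitian_gram hx).det_mem_Icc_of_quadraticForm (by positivity) fun v => ?_
  rw [dotProduct_gram_mulVec]
  exact H.form_fderiv_bounds hx v

theorem continuousOn_fderiv_graphMap : ContinuousOn (fderiv ℝ (graphMap u)) A :=
  H.contDiffOn_graphMap.continuousOn_fderiv_of_isOpen H.isOpen (by simp)

theorem continuousOn_form_graphMap : ContinuousOn (fun x => g.form (graphMap u x)) A :=
  g.smooth.continuousOn.comp H.continuousOn_graphMap fun _ hx => hx

theorem continuousOn_gram : ContinuousOn (gram g u) A := by
  refine continuousOn_pi.2 fun i => continuousOn_pi.2 fun j => ?_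
  exact (H.continuousOn_form_graphMap.clm_apply
    (H.continuousOn_fderiv_graphMap.clm_apply continuousOn_const)).clm_apply
      (H.continuousOn_fderiv_graphMap.clm_apply continuousOn_const)

theorem continuousOn_det_gram : ContinuousOn (fun x => (gram g u x).det) A :=
  (continuous_id.matrix_det).comp_continuousOn H.continuousOn_gram

theorem continuousOn_inv_gram : ContinuousOn (fun x => (gram g u x)⁻¹) A := by
  have h : ∀ x, (gram g u x)⁻¹ = (gram g u x).det⁻¹ • (gram g u x).adjugate := fun x => by
    rw [Matrix.inv_def, Ring.inverse_eq_inv']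
  simp_rw [h]
  refine ContinuousOn.smul (H.continuousOn_det_gram.inv₀ fun x hx => ?_)
    ((continuous_id.matrix_adjugate).comp_continuousOn H.continuousOn_gram)
  have := H.pos
  exact (lt_of_lt_of_le (by positivity) (H.det_gram_bounds hx).1).ne'

end IsControlledGraph

end Chart

end NeckStability

/-! ### Integration over the graph. -/

namespace NeckStability

variable {n : ℕ} {A : Set (Base n)} {g : RiemannianMetricOn (cylinderOver A)} {u : Base n → ℝ}

namespace IsControlledGraph

variable {K : ℝ} (H : IsControlledGraph K g u)
include H

theorem aemeasurable_density : AEMeasurable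
    (fun x => ENNReal.ofReal (Real.sqrt (gram g u x).det)) (volume.restrict A) :=
  ((H.continuousOn_det_gram.sqrt).aemeasurable H.isOpen.measurableSet).ennreal_ofReal

theorem aemeasurable_graphMap : AEMeasurable (graphMap u) ((volume.restrict A).withDensity
    fun x => ENNReal.ofReal (Real.sqrt (gram g u x).det)) :=
  (H.continuousOn_graphMap.aemeasurable H.isOpen.measurableSet).mono_ac
    (withDensity_absolutelyContinuous _ _)

theorem density_bounds {x : Base n} (hx : x ∈ A) :
    ENNReal.ofReal (Real.sqrt ((1 / K) ^ n)) ≤ ENNReal.ofReal (Real.sqrt (gram g u x).det) ∧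
    ENNReal.ofReal (Real.sqrt (gram g u x).det) ≤
      ENNReal.ofReal (Real.sqrt ((5 / 4 * K) ^ n)) := by
  have := H.det_gram_bounds hx
  constructor <;> gcongr <;> tauto

/-- Integration over the graph in its global chart. -/
theorem lintegral_graphVolume {f : Ambient n → ℝ≥0∞} (hf : AEMeasurable f (graphVolume g u)) :
    ∫⁻ p, f p ∂graphVolume g u =
      ∫⁻ x in A, ENNReal.ofReal (Real.sqrt (gram g u x).det) * f (graphMap u x) := by
  rw [graphVolume, lintegral_map' hf H.aemeasurable_graphMap,
    lintegral_withDensity_eq_lintegral_mul_non_measurable₀ _ H.aemeasurable_density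
      (Filter.Eventually.of_forall fun _ => ENNReal.ofReal_lt_top)]
  rfl

/-- The volume measure is carried by the graph, so ambient integrands may be replaced by functions
of the base point. -/
theorem ae_eq_graphMap_fst : ∀ᵐ p ∂graphVolume g u, p.1 ∈ A ∧ graphMap u p.1 = p := by
  classical
  have hAm := H.isOpen.measurableSet
  -- Nothing is known about `u` off `A`; modifying it there makes the set in the claim visibly
  -- measurable, as `ae_map_iff` demands.
  have hmeas : Measurable (A.piecewise u 0) :=
    H.smooth.continuousOn.measurable_piecewise continuousOn_const hAm
  have hset : {p : Ambient n | p.1 ∈ A ∧ graphMap u p.1 = p} =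
      {p | p.1 ∈ A} ∩ {p | A.piecewise u 0 p.1 = p.2} := by
    ext p
    simp only [Set.mem_ofPred_eq, Set.mem_inter_iff]
    refine and_congr_right fun hp => ?_
    rw [Set.piecewise_eq_of_mem _ _ _ hp, graphMap, Prod.ext_iff]
    simp
  rw [graphVolume, ae_map_iff H.aemeasurable_graphMap]
  · refine (withDensity_absolutelyContinuous _ _).ae_le ?_
    filter_upwards [ae_restrict_mem hAm] with x hx
    exact ⟨hx, rfl⟩
  · rw [hset]
    exact (measurable_fst hAm).inter
      (measurableSet_eq_fun (hmeas.comp measurable_fst) measurable_snd)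

theorem quasiMeasurePreserving_fst :
    Measure.QuasiMeasurePreserving (Prod.fst : Ambient n → Base n) (graphVolume g u)
      (volume.restrict A) := by
  refine ⟨measurable_fst, ?_⟩
  rw [graphVolume, AEMeasurable.map_map_of_aemeasurable measurable_fst.aemeasurable
    H.aemeasurable_graphMap]
  change (Measure.map id _).AbsolutelyContinuous _
  rw [Measure.map_id]
  exact withDensity_absolutelyContinuous _ _

/-- The volume density is bounded below by a positive constant on `A`, so null sets of the graph
project to Lebesgue null sets. -/
theorem ae_restrict_of_ae_graphVolume {P : Ambient n → Prop} (h : ∀ᵐ p ∂graphVolume g u, P p) :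
    ∀ᵐ x ∂volume.restrict A, P (graphMap u x) := by
  refine (withDensity_absolutelyContinuous' H.aemeasurable_density ?_).ae_le
    (ae_of_ae_map H.aemeasurable_graphMap h)
  filter_upwards [ae_restrict_mem H.isOpen.measurableSet] with x hx
  have := H.pos
  exact (lt_of_lt_of_le (by simp; positivity) (H.density_bounds hx).1).ne'

theorem lintegral_fst_bounds {f : Base n → ℝ≥0∞} (hf : AEMeasurable f (volume.restrict A)) :
    ENNReal.ofReal (Real.sqrt ((1 / K) ^ n)) * ∫⁻ x in A, f x ≤
        ∫⁻ p, f p.1 ∂graphVolume g u ∧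
      ∫⁻ p, f p.1 ∂graphVolume g u ≤
        ENNReal.ofReal (Real.sqrt ((5 / 4 * K) ^ n)) * ∫⁻ x in A, f x := by
  have hf' : AEMeasurable (fun p : Ambient n => f p.1) (graphVolume g u) :=
    hf.comp_quasiMeasurePreserving H.quasiMeasurePreserving_fst
  rw [H.lintegral_graphVolume hf',
    ← lintegral_const_mul' _ _ ENNReal.ofReal_ne_top,
    ← lintegral_const_mul' _ _ ENNReal.ofReal_ne_top]
  constructor <;> refine setLIntegral_mono' H.isOpen.measurableSet fun x hx => ?_
  · exact mul_le_mul_left (H.density_bounds hx).1 _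
  · exact mul_le_mul_left (H.density_bounds hx).2 _

theorem graphVolume_preimage_fst_le {E : Set (Base n)} (hE : MeasurableSet E) :
    graphVolume g u (Prod.fst ⁻¹' E) ≤
      ENNReal.ofReal (Real.sqrt ((5 / 4 * K) ^ n)) * volume E := by
  have h := (H.lintegral_fst_bounds (f := E.indicator 1)
    (measurable_one.indicator hE).aemeasurable).2
  have h1 : ∫⁻ p, E.indicator 1 p.1 ∂graphVolume g u = graphVolume g u (Prod.fst ⁻¹' E) := by
    rw [← lintegral_indicator_one (measurable_fst hE)]; rfl
  rw [h1] at h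
  refine h.trans ?_
  gcongr
  rw [lintegral_indicator_one hE]
  exact Measure.restrict_apply_le _ _

/-- `g.form` is arbitrary off the cylinder, but the cylinder carries the measure and the form is
continuous on it. -/
theorem aestronglyMeasurable_form_self {Z : Ambient n → Ambient n}
    (hZ : AEStronglyMeasurable Z (graphVolume g u)) :
    AEStronglyMeasurable (fun p => g.form p (Z p) (Z p)) (graphVolume g u) := by
  have h1 : AEStronglyMeasurable g.form (graphVolume g u) := by
    have := g.smooth.continuousOn.aestronglyMeasurable (μ := graphVolume g u)
      (isOpen_cylinderOver H.isOpen).measurableSet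
    rwa [Measure.restrict_eq_self_of_ae_mem] at this
    filter_upwards [H.ae_eq_graphMap_fst] with p hp using hp.1
  have h2 := isBoundedBilinearMap_apply.continuous.comp_aestronglyMeasurable (h1.prodMk hZ)
  exact isBoundedBilinearMap_apply.continuous.comp_aestronglyMeasurable (h2.prodMk hZ)

/-- The differential of a function in the chart is controlled by its gradient. -/
theorem enorm_fderiv_sq_le {φ : Ambient n → ℝ} {Y : Ambient n → Ambient n}
    (hY : IsGradient g u φ Y) {x : Base n} (hx : x ∈ A) :
    ‖fderiv ℝ (fun y => φ (graphMap u y)) x‖ₑ ^ 2 ≤ ENNReal.ofReal (5 / 4 * K) *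
      ENNReal.ofReal (g.form (graphMap u x) (Y (graphMap u x)) (Y (graphMap u x))) := by
  have hp := graphMap_mem_cylinderOver (u := u) hx
  have hK := H.pos
  set Q := g.form (graphMap u x) (Y (graphMap u x)) (Y (graphMap u x)) with hQ
  have hQ0 : 0 ≤ Q := RiemannianMetricOn.form_self_nonneg hp _
  have hle : ‖fderiv ℝ (fun y => φ (graphMap u y)) x‖ ≤ Real.sqrt (5 / 4 * K * Q) := by
    refine ContinuousLinearMap.opNorm_le_bound _ (Real.sqrt_nonneg _) fun v => ?_
    rw [← (hY x hx).2 v, Real.norm_eq_abs]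
    refine abs_le_of_sq_le_sq ?_ (by positivity)
    rw [mul_pow, Real.sq_sqrt (by positivity)]
    refine (RiemannianMetricOn.form_sq_le hp _ _).trans ?_
    have := mul_le_mul_of_nonneg_left (H.form_fderiv_bounds hx v).2 hQ0
    linarith
  rw [← ENNReal.ofReal_mul (by positivity), ← ofReal_norm, ← ENNReal.ofReal_pow (norm_nonneg _)]
  refine ENNReal.ofReal_le_ofReal ?_
  calc _ ≤ Real.sqrt (5 / 4 * K * Q) ^ 2 := by gcongr
    _ = _ := Real.sq_sqrt (by positivity)

end IsControlledGraph

/-- The chart representation of a compactly supported `C¹` function on the graph, extended by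
zero, is `C¹` with compact support in the base. -/
theorem IsC1c.indicator_contDiff {φ : Ambient n → ℝ} (hA : IsOpen A) (hφ : IsC1c A u φ) :
    ContDiff ℝ 1 (A.indicator fun x => φ (graphMap u x)) ∧
      HasCompactSupport (A.indicator fun x => φ (graphMap u x)) ∧
      tsupport (A.indicator fun x => φ (graphMap u x)) ⊆ A := by
  obtain ⟨hC, S, hS, hSg, hz⟩ := hφ
  have hS' : IsCompact (Prod.fst '' S) := hS.image continuous_fst
  have hsub : Prod.fst '' S ⊆ A := by
    rintro _ ⟨p, hp, rfl⟩
    obtain ⟨x, hx, rfl⟩ := hSg hp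
    exact hx
  have hzero : ∀ x, x ∉ Prod.fst '' S → A.indicator (fun x => φ (graphMap u x)) x = 0 := by
    intro x hx
    by_cases hxA : x ∈ A
    · rw [Set.indicator_of_mem hxA]
      exact hz _ ⟨x, hxA, rfl⟩ fun h => hx ⟨_, h, rfl⟩
    · exact Set.indicator_of_notMem hxA _
  refine ⟨contDiff_iff_contDiffAt.2 fun x => ?_, HasCompactSupport.intro hS' hzero,
    (closure_minimal (Function.support_subset_iff'.2 hzero) hS'.isClosed).trans hsub⟩
  by_cases hx : x ∈ A
  · refine (hC.contDiffAt (hA.mem_nhds hx)).congr_of_eventuallyEq ?_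
    filter_upwards [hA.mem_nhds hx] with y hy
    exact Set.indicator_of_mem hy _
  · refine (contDiffAt_const (c := (0 : ℝ))).congr_of_eventuallyEq ?_
    filter_upwards [hS'.isClosed.isOpen_compl.mem_nhds fun h => hx (hsub h)] with y hy
    exact hzero y hy

end NeckStability

/-! ### The weighted Sobolev inequality on the graph. -/

namespace NeckStability

open Filter

/-- The weighted Sobolev inequality on graphs, for functions of class `C¹_c`. -/
theorem exists_weighted_sobolev_C1c (n : ℕ) (hn : 3 ≤ n) (K : ℝ) : ∃ C : ℝ≥0,
    ∀ (A : Set (Base n)) (g : RiemannianMetricOn (cylinderOver A)) (u : Base n → ℝ),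
      IsControlledGraph K g u → ∀ (W : ℝ), 0 < W → ∀ ω : Ambient n → ℝ,
      AEStronglyMeasurable ω (graphVolume g u) →
      lorentzNorm (graphVolume g u) ((n : ℝ) / 2) ω ≤ ENNReal.ofReal W →
      ∀ (φ : Ambient n → ℝ) (Y : Ambient n → Ambient n), IsC1c A u φ → IsGradient g u φ Y →
      ∫⁻ p, ‖φ p‖ₑ ^ 2 * ‖ω p‖ₑ ∂graphVolume g u ≤
        C * ENNReal.ofReal W * ∫⁻ p, ENNReal.ofReal (g.form p (Y p) (Y p)) ∂graphVolume g u := by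
  obtain ⟨C, hC⟩ := exists_weighted_sobolev n hn
  have hn' : (3 : ℝ) ≤ n := by exact_mod_cast hn
  set s : ℝ := (n : ℝ) / 2 / ((n : ℝ) / 2 - 1)
  set a : ℝ := Real.sqrt ((1 / K) ^ n)
  set b : ℝ := Real.sqrt ((5 / 4 * K) ^ n)
  -- The factors come from Sobolev in `ℝⁿ`, from `p / (p - 1)` at `p = n / 2`, from the upper and
  -- lower bounds of the volume density, and from comparing `|dh|²` with `|∇φ|²`.
  refine ⟨C * s.toNNReal * b.toNNReal ^ (1 - 2 / (n : ℝ)) * a.toNNReal⁻¹ * (5 / 4 * K).toNNReal,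
    fun A g u H W hW ω hωm hω φ Y hφ hY => ?_⟩
  have hAm := H.isOpen.measurableSet
  have hK := H.pos
  have ha : 0 < a := Real.sqrt_pos.2 (by positivity)
  have hexp : 0 ≤ 1 - 2 / (n : ℝ) := by
    rw [sub_nonneg, div_le_one (by linarith)]; linarith
  set h : Base n → ℝ := A.indicator fun x => φ (graphMap u x) with hh
  obtain ⟨hhC, hhs, hhA⟩ := hφ.indicator_contDiff H.isOpen
  -- The volume density is absorbed into the weight, for which only integrals over sets need to be
  -- controlled.
  set w : Base n → ℝ≥0∞ := A.indicator fun x =>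
    ENNReal.ofReal (Real.sqrt (gram g u x).det) * ‖ω (graphMap u x)‖ₑ with hw
  have hφh : ∀ᵐ p ∂graphVolume g u, φ p = h p.1 := by
    filter_upwards [H.ae_eq_graphMap_fst] with p hp
    rw [hh, Set.indicator_of_mem hp.1, hp.2]
  have hwE : ∀ E, MeasurableSet E → ∫⁻ x in E, w x ≤
      (ENNReal.ofReal (s * W) * ENNReal.ofReal b ^ (1 - 2 / (n : ℝ))) *
        volume E ^ (1 - 2 / (n : ℝ)) := by
    intro E hE
    have hE' : MeasurableSet (Prod.fst ⁻¹' E : Set (Ambient n)) := measurable_fst hE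
    have h1 : ∫⁻ x in E, w x = ∫⁻ p in Prod.fst ⁻¹' E, ‖ω p‖ₑ ∂graphVolume g u := by
      rw [← lintegral_indicator hE', H.lintegral_graphVolume (hωm.enorm.indicator hE'),
        ← lintegral_indicator hE, ← lintegral_indicator hAm]
      refine lintegral_congr fun x => ?_
      by_cases hxA : x ∈ A <;> by_cases hxE : x ∈ E <;>
        simp [hw, hxA, hxE, Set.indicator, graphMap]
    have h2 := setLIntegral_le_of_lorentzNorm_le (p := (n : ℝ) / 2) (by linarith) hW hωm hω
      (Prod.fst ⁻¹' E)
    rw [one_div_div] at h2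
    rw [h1, mul_assoc, ← ENNReal.mul_rpow_of_nonneg _ _ hexp]
    refine h2.trans ?_
    gcongr
    exact H.graphVolume_preimage_fst_le hE
  have hleft : ∫⁻ p, ‖φ p‖ₑ ^ 2 * ‖ω p‖ₑ ∂graphVolume g u = ∫⁻ x, ‖h x‖ₑ ^ 2 * w x := by
    have hm : AEMeasurable (fun p : Ambient n => ‖h p.1‖ₑ ^ 2 * ‖ω p‖ₑ) (graphVolume g u) :=
      ((hhC.continuous.measurable.comp measurable_fst).enorm.pow_const 2).aemeasurable.mul hωm.enorm
    rw [lintegral_congr_ae (g := fun p : Ambient n => ‖h p.1‖ₑ ^ 2 * ‖ω p‖ₑ)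
      (by filter_upwards [hφh] with p hp; rw [hp]), H.lintegral_graphVolume hm,
      ← lintegral_indicator hAm]
    refine lintegral_congr fun x => ?_
    by_cases hxA : x ∈ A
    · simp only [hw, Set.indicator_of_mem hxA, graphMap]; ring
    · simp [hw, hxA]
  have hdh0 : ∀ x, x ∉ A → fderiv ℝ h x = 0 := by
    intro x hx
    by_contra hne
    exact hx (hhA (support_fderiv_subset ℝ hne))
  have hright : ENNReal.ofReal a * ∫⁻ x, ‖fderiv ℝ h x‖ₑ ^ 2 ≤ ENNReal.ofReal (5 / 4 * K) *
      ∫⁻ p, ENNReal.ofReal (g.form p (Y p) (Y p)) ∂graphVolume g u := by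
    have hm : Measurable fun x => ‖fderiv ℝ h x‖ₑ ^ 2 :=
      (hhC.continuous_fderiv one_ne_zero).enorm.measurable.pow_const 2
    have hAint : ∫⁻ x, ‖fderiv ℝ h x‖ₑ ^ 2 = ∫⁻ x in A, ‖fderiv ℝ h x‖ₑ ^ 2 := by
      rw [← lintegral_indicator hAm]
      refine lintegral_congr fun x => ?_
      by_cases hxA : x ∈ A
      · rw [Set.indicator_of_mem hxA]
      · rw [Set.indicator_of_notMem hxA, hdh0 x hxA, enorm_zero (E := Base n →L[ℝ] ℝ)]; simp
    rw [hAint, ← lintegral_const_mul' (ENNReal.ofReal (5 / 4 * K)) _ ENNReal.ofReal_ne_top]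
    refine (H.lintegral_fst_bounds hm.aemeasurable).1.trans (lintegral_mono_ae ?_)
    filter_upwards [H.ae_eq_graphMap_fst] with p hp
    have h1 : fderiv ℝ h p.1 = fderiv ℝ (fun y => φ (graphMap u y)) p.1 := by
      refine EventuallyEq.fderiv_eq ?_
      filter_upwards [H.isOpen.mem_nhds hp.1] with y hy using Set.indicator_of_mem hy _
    have h2 := H.enorm_fderiv_sq_le hY hp.1
    rwa [hp.2, ← h1] at h2
  have hright' : ∫⁻ x, ‖fderiv ℝ h x‖ₑ ^ 2 ≤ (ENNReal.ofReal a)⁻¹ * (ENNReal.ofReal (5 / 4 * K) *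
      ∫⁻ p, ENNReal.ofReal (g.form p (Y p) (Y p)) ∂graphVolume g u) := by
    calc ∫⁻ x, ‖fderiv ℝ h x‖ₑ ^ 2
        = (ENNReal.ofReal a)⁻¹ * (ENNReal.ofReal a * ∫⁻ x, ‖fderiv ℝ h x‖ₑ ^ 2) := by
          rw [← mul_assoc, ENNReal.inv_mul_cancel (by simpa using ha) ENNReal.ofReal_ne_top,
            one_mul]
      _ ≤ _ := by gcongr
  have hs0 : 0 ≤ s := div_nonneg (by linarith) (by linarith)
  calc _ ≤ _ := hleft.le
    _ ≤ C * (ENNReal.ofReal (s * W) * ENNReal.ofReal b ^ (1 - 2 / (n : ℝ))) *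
        ∫⁻ x, ‖fderiv ℝ h x‖ₑ ^ 2 := hC h hhC hhs w _ hwE
    _ ≤ C * (ENNReal.ofReal (s * W) * ENNReal.ofReal b ^ (1 - 2 / (n : ℝ))) *
        ((ENNReal.ofReal a)⁻¹ * (ENNReal.ofReal (5 / 4 * K) *
          ∫⁻ p, ENNReal.ofReal (g.form p (Y p) (Y p)) ∂graphVolume g u)) := by gcongr
    _ = _ := by
        have ha' : a.toNNReal ≠ 0 := by simpa using ha
        simp only [ENNReal.coe_mul, ENNReal.coe_inv ha', ENNReal.coe_rpow_of_nonneg _ hexp,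
          ENNReal.ofReal_mul hs0]
        simp only [ENNReal.ofReal]
        ring

/-- The weighted Sobolev inequality on `W^{1,2}_0` of a graph. -/
theorem exists_weighted_sobolev_W012 (n : ℕ) (hn : 3 ≤ n) (K : ℝ) : ∃ C : ℝ≥0,
    ∀ (A : Set (Base n)) (g : RiemannianMetricOn (cylinderOver A)) (u : Base n → ℝ),
      IsControlledGraph K g u → ∀ (W : ℝ), 0 < W → ∀ ω : Ambient n → ℝ,
      AEStronglyMeasurable ω (graphVolume g u) →
      lorentzNorm (graphVolume g u) ((n : ℝ) / 2) ω ≤ ENNReal.ofReal W →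
      ∀ (f : Ambient n → ℝ) (Z : Ambient n → Ambient n), IsW012 g u f Z →
      ∫⁻ p, ‖f p‖ₑ ^ 2 * ‖ω p‖ₑ ∂graphVolume g u ≤
        C * ENNReal.ofReal W * ∫⁻ p, ENNReal.ofReal (g.form p (Z p) (Z p)) ∂graphVolume g u := by
  obtain ⟨C, hC⟩ := exists_weighted_sobolev_C1c n hn K
  -- The `2` comes from `|Y|² ≤ 2|Z|² + 2|Z - Y|²` for approximating gradients `Y`.
  refine ⟨2 * C, fun A g u H W hW ω hωm hω f Z hf => ?_⟩
  obtain ⟨hW12, happ⟩ := hf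
  set μ := graphVolume g u with hμ
  choose φ Y hφ hY hδ using fun k : ℕ => happ ((k : ℝ≥0∞) + 1)⁻¹ (by simp)
  have hφm : ∀ k, AEStronglyMeasurable (φ k) μ := fun k => by
    have h1 := ((hφ k).indicator_contDiff H.isOpen).1.continuous
    refine ((h1.comp continuous_fst).aestronglyMeasurable (μ := μ)).congr ?_
    filter_upwards [H.ae_eq_graphMap_fst] with p hp
    simp only [Function.comp]
    rw [Set.indicator_of_mem hp.1, hp.2]
  have hcyl : ∀ᵐ p ∂μ, p ∈ cylinderOver A := by
    filter_upwards [H.ae_eq_graphMap_fst] with p hp using hp.1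
  have hfφ : ∀ k, ∫⁻ p, ‖φ k p - f p‖ₑ ^ 2 ∂μ ≤ ((k : ℝ≥0∞) + 1)⁻¹ := fun k => by
    refine le_trans (lintegral_mono_ae ?_) (hδ k).le
    filter_upwards [hcyl] with p hp
    rw [Real.enorm_eq_ofReal_abs, ← ENNReal.ofReal_pow (abs_nonneg _), sq_abs]
    refine ENNReal.ofReal_le_ofReal ?_
    have := RiemannianMetricOn.form_self_nonneg (g := g) hp (Z p - Y k p)
    nlinarith
  have hZY : ∀ k, ∫⁻ p, ENNReal.ofReal (g.form p (Y k p) (Y k p)) ∂μ ≤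
      2 * ∫⁻ p, ENNReal.ofReal (g.form p (Z p) (Z p)) ∂μ + 2 * ((k : ℝ≥0∞) + 1)⁻¹ := fun k => by
    have hm : AEMeasurable (fun p => ENNReal.ofReal (g.form p (Z p) (Z p))) μ :=
      (H.aestronglyMeasurable_form_self hW12.measurable_grad).aemeasurable.ennreal_ofReal
    calc ∫⁻ p, ENNReal.ofReal (g.form p (Y k p) (Y k p)) ∂μ
        ≤ ∫⁻ p, (2 * ENNReal.ofReal (g.form p (Z p) (Z p)) +
          2 * ENNReal.ofReal ((f p - φ k p) ^ 2 + g.form p (Z p - Y k p) (Z p - Y k p))) ∂μ := by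
          refine lintegral_mono_ae ?_
          filter_upwards [hcyl] with p hp
          have h0 := RiemannianMetricOn.form_self_nonneg (g := g) hp (Z p)
          have h1 := RiemannianMetricOn.form_self_nonneg (g := g) hp (Z p - Y k p)
          -- `2|Z|² + 2|Z - Y|² - |Y|² = |2Z - Y|²`.
          have h2 := RiemannianMetricOn.form_self_nonneg (g := g) hp ((2 : ℝ) • Z p - Y k p)
          have h3 : 0 ≤ (f p - φ k p) ^ 2 := sq_nonneg _
          have key : ∀ a b c : ℝ, 0 ≤ a → 0 ≤ b → c ≤ 2 * a + 2 * b →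
              ENNReal.ofReal c ≤ 2 * ENNReal.ofReal a + 2 * ENNReal.ofReal b := by
            intro a b c ha hb hc
            rw [← ENNReal.ofReal_ofNat 2, ← ENNReal.ofReal_mul two_pos.le,
              ← ENNReal.ofReal_mul two_pos.le, ← ENNReal.ofReal_add (by linarith) (by linarith)]
            exact ENNReal.ofReal_le_ofReal hc
          refine key _ _ _ h0 (by linarith) ?_
          simp only [map_sub, map_smul, sub_apply, smul_apply, smul_eq_mul,
            g.symm p hp (Y k p) (Z p)] at h1 h2 ⊢
          linarith
      _ = 2 * ∫⁻ p, ENNReal.ofReal (g.form p (Z p) (Z p)) ∂μ + 2 * ∫⁻ p, ENNReal.ofReal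
            ((f p - φ k p) ^ 2 + g.form p (Z p - Y k p) (Z p - Y k p)) ∂μ := by
          rw [lintegral_add_left' (hm.const_mul 2), lintegral_const_mul' _ _ (by norm_num),
            lintegral_const_mul' _ _ (by norm_num)]
      _ ≤ _ := by gcongr; exact (hδ k).le
  have hinv : Tendsto (fun k : ℕ => ((k : ℝ≥0∞) + 1)⁻¹) atTop (nhds 0) := by
    have := (tendsto_add_atTop_iff_nat 1).2 ENNReal.tendsto_inv_nat_nhds_zero
    simpa using this
  have hL2 : Tendsto (fun k => eLpNorm (φ k - f) 2 μ) atTop (nhds 0) := by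
    have h1 : ∀ k, eLpNorm (φ k - f) 2 μ ≤ (((k : ℝ≥0∞) + 1)⁻¹) ^ (1 / 2 : ℝ) := fun k => by
      rw [eLpNorm_eq_lintegral_rpow_enorm_toReal (by norm_num) (by norm_num)]
      simp only [ENNReal.toReal_ofNat, ENNReal.rpow_ofNat, Pi.sub_apply]
      gcongr
      exact hfφ k
    refine tendsto_of_tendsto_of_tendsto_of_le_of_le tendsto_const_nhds ?_ (fun _ => zero_le) h1
    have := hinv.ennrpow_const (1 / 2 : ℝ)
    rwa [ENNReal.zero_rpow_of_pos (by norm_num)] at this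
  -- Almost everywhere convergence along a subsequence is what Fatou's lemma needs; it avoids
  -- assuming beforehand that `f² ω` is integrable.
  obtain ⟨ns, hns, hae⟩ := (tendstoInMeasure_of_tendsto_eLpNorm two_ne_zero hφm hW12.measurable
    hL2).exists_seq_tendsto_ae
  calc ∫⁻ p, ‖f p‖ₑ ^ 2 * ‖ω p‖ₑ ∂μ
      ≤ ∫⁻ p, liminf (fun k => ‖φ (ns k) p‖ₑ ^ 2 * ‖ω p‖ₑ) atTop ∂μ := by
        refine lintegral_mono_ae ?_
        filter_upwards [hae] with p hp
        refine (Tendsto.liminf_eq ?_).ge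
        refine ENNReal.Tendsto.mul_const ?_ (Or.inr enorm_ne_top)
        exact ((ENNReal.continuous_pow 2).tendsto _).comp ((continuous_enorm.tendsto _).comp hp)
    _ ≤ liminf (fun k => ∫⁻ p, ‖φ (ns k) p‖ₑ ^ 2 * ‖ω p‖ₑ ∂μ) atTop :=
        lintegral_liminf_le' fun k => ((hφm _).enorm.pow_const 2).mul hωm.enorm
    _ ≤ liminf (fun k => C * ENNReal.ofReal W *
          (2 * ∫⁻ p, ENNReal.ofReal (g.form p (Z p) (Z p)) ∂μ +
            2 * ((ns k : ℝ≥0∞) + 1)⁻¹)) atTop := by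
        refine liminf_le_liminf (Eventually.of_forall fun k => ?_)
        refine (hC A g u H W hW ω hωm hω _ _ (hφ _) (hY _)).trans ?_
        gcongr
        exact hZY _
    _ = C * ENNReal.ofReal W * (2 * ∫⁻ p, ENNReal.ofReal (g.form p (Z p) (Z p)) ∂μ + 2 * 0) := by
        refine Tendsto.liminf_eq ?_
        refine ENNReal.Tendsto.const_mul (tendsto_const_nhds.add ?_) (Or.inr (by finiteness))
        exact ENNReal.Tendsto.const_mul (hinv.comp hns.tendsto_atTop) (Or.inr (by norm_num))
    _ = _ := by push_cast; ring

end NeckStability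

/-! ### Explicit gradients of test functions. -/

namespace NeckStability

open Filter

section Gradient

variable {n : ℕ} {A : Set (Base n)} {g : RiemannianMetricOn (cylinderOver A)} {u : Base n → ℝ}

/-- The gradient on the graph of `u` of the function `h`, as a function of the base point. -/
noncomputable def chartGradient (g : RiemannianMetricOn (cylinderOver A)) (u h : Base n → ℝ)
    (x : Base n) : Ambient n :=
  fderiv ℝ (graphMap u) x (WithLp.toLp 2 ((gram g u x)⁻¹.mulVec
    fun j => fderiv ℝ h x (EuclideanSpace.single j 1)))

theorem chartGradient_eq_zero {h : Base n → ℝ} {x : Base n} (hx : x ∉ tsupport h) :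
    chartGradient g u h x = 0 := by
  have : fderiv ℝ h x = 0 := by
    by_contra hne
    exact hx (support_fderiv_subset ℝ hne)
  have hz : (fun j : Fin n => fderiv ℝ h x (EuclideanSpace.single j 1)) = 0 := by
    rw [this]; rfl
  rw [chartGradient, hz, Matrix.mulVec_zero, WithLp.toLp_zero, map_zero]

namespace IsControlledGraph

variable {K : ℝ} (H : IsControlledGraph K g u)
include H

theorem continuousOn_chartGradient {h : Base n → ℝ} (hh : ContDiff ℝ 1 h) :
    ContinuousOn (chartGradient g u h) A := by
  refine H.continuousOn_fderiv_graphMap.clm_apply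
    ((PiLp.continuous_toLp 2 _).comp_continuousOn ?_)
  have h1 : Continuous fun x => fun j : Fin n =>
      fderiv ℝ h x (EuclideanSpace.single j (1 : ℝ)) :=
    continuous_pi fun j => (hh.continuous_fderiv one_ne_zero).clm_apply continuous_const
  have h2 : Continuous fun q : Matrix (Fin n) (Fin n) ℝ × (Fin n → ℝ) => q.1.mulVec q.2 :=
    continuous_fst.matrix_mulVec continuous_snd
  exact h2.comp_continuousOn (H.continuousOn_inv_gram.prodMk h1.continuousOn)

/-- Raising the index of `dh` with the inverse Gram matrix, which exists because the determinant is
positive on `A`. -/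
theorem form_chartGradient (h : Base n → ℝ) {x : Base n} (hx : x ∈ A) (v : Base n) :
    g.form (graphMap u x) (chartGradient g u h x) (fderiv ℝ (graphMap u) x v) =
      fderiv ℝ h x v := by
  have hK := H.pos
  have hdet : IsUnit (gram g u x).det :=
    (lt_of_lt_of_le (by positivity) (H.det_gram_bounds hx).1).ne'.isUnit
  rw [g.symm _ (graphMap_mem_cylinderOver hx), chartGradient, ← dotProduct_gram_mulVec,
    Matrix.mulVec_mulVec, Matrix.mul_nonsing_inv _ hdet, Matrix.one_mulVec]
  have hexp : v = ∑ i, v i • EuclideanSpace.single i (1 : ℝ) := by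
    simpa using ((EuclideanSpace.basisFun (Fin n) ℝ).sum_repr v).symm
  conv_rhs => rw [hexp]
  simp [dotProduct]

theorem isGradient_chartGradient (h : Base n → ℝ) :
    IsGradient g u (fun p => h p.1) fun p => chartGradient g u h p.1 :=
  fun _ hx => ⟨⟨_, rfl⟩, fun v => H.form_chartGradient h hx v⟩

theorem sobolevNormSq_chartGradient_lt_top {h : Base n → ℝ} (hh : ContDiff ℝ 1 h)
    (hs : HasCompactSupport h) (hsA : tsupport h ⊆ A) :
    sobolevNormSq g u (fun p => h p.1) (fun p => chartGradient g u h p.1) < ∞ := by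
  set r : Base n → ℝ := fun x => h x ^ 2 +
    g.form (graphMap u x) (chartGradient g u h x) (chartGradient g u h x) with hr
  have hrc : ContinuousOn r A := (hh.continuous.continuousOn.pow 2).add
    ((H.continuousOn_form_graphMap.clm_apply (H.continuousOn_chartGradient hh)).clm_apply
      (H.continuousOn_chartGradient hh))
  have hrz : ∀ x, x ∉ tsupport h → r x = 0 := fun x hx => by
    simp [hr, chartGradient_eq_zero hx, image_eq_zero_of_notMem_tsupport hx]
  have hint : IntegrableOn r (tsupport h) := (hrc.mono hsA).integrableOn_compact hs
  calc sobolevNormSq g u (fun p => h p.1) (fun p => chartGradient g u h p.1)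
      = ∫⁻ p, ENNReal.ofReal (r p.1) ∂graphVolume g u := by
        refine lintegral_congr_ae ?_
        filter_upwards [H.ae_eq_graphMap_fst] with p hp
        simp only [hr, hp.2]
    _ ≤ ENNReal.ofReal (Real.sqrt ((5 / 4 * K) ^ n)) * ∫⁻ x in A, ENNReal.ofReal (r x) :=
        (H.lintegral_fst_bounds (hrc.aemeasurable H.isOpen.measurableSet).ennreal_ofReal).2
    _ ≤ ENNReal.ofReal (Real.sqrt ((5 / 4 * K) ^ n)) *
          ∫⁻ x in tsupport h, ENNReal.ofReal (r x) := by
        refine mul_le_mul_right ?_ _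
        rw [← lintegral_indicator (isClosed_tsupport h).measurableSet]
        refine (lintegral_mono fun x => ?_).trans (setLIntegral_le_lintegral A _)
        by_cases hx : x ∈ tsupport h
        · rw [Set.indicator_of_mem hx]
        · rw [Set.indicator_of_notMem hx, hrz x hx, ENNReal.ofReal_zero]
    _ < ∞ := ENNReal.mul_lt_top ENNReal.ofReal_lt_top hint.lintegral_lt_top

/-- Pairing with `dF(v)` turns the metric term into `dh(v)`; since `ψ` is supported in `A`, both
integrals extend to `ℝⁿ`, where this is integration by parts. -/
theorem isWeakGradient_chartGradient {h : Base n → ℝ} (hh : ContDiff ℝ 1 h)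
    (hs : HasCompactSupport h) :
    IsWeakGradient g u (fun p => h p.1) fun p => chartGradient g u h p.1 := by
  refine ⟨Eventually.of_forall fun p => ⟨_, rfl⟩, fun ψ hψ hψs hψA v => ?_⟩
  have hψ1 : ContDiff ℝ 1 ψ := hψ.of_le (by exact_mod_cast le_top)
  have hcongr : ∫ x in A, g.form (graphMap u x) (chartGradient g u h x)
      (fderiv ℝ (graphMap u) x v) * ψ x = ∫ x in A, fderiv ℝ h x v * ψ x :=
    setIntegral_congr_fun H.isOpen.measurableSet fun x hx => by
      simp only [H.form_chartGradient h hx]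
  change ∫ x in A, h x * fderiv ℝ ψ x v = -∫ x in A, g.form (graphMap u x)
    (chartGradient g u h x) (fderiv ℝ (graphMap u) x v) * ψ x
  have hψ0 : ∀ x, x ∉ A → ψ x = 0 := fun x hx =>
    image_eq_zero_of_notMem_tsupport fun h' => hx (hψA h')
  have hdψ0 : ∀ x, x ∉ A → fderiv ℝ ψ x = 0 := fun x hx => by
    by_contra hne
    exact hx (hψA (support_fderiv_subset ℝ hne))
  rw [hcongr, setIntegral_eq_integral_of_forall_compl_eq_zero fun x hx => by simp [hdψ0 x hx],
    setIntegral_eq_integral_of_forall_compl_eq_zero fun x hx => by simp [hψ0 x hx]]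
  have hdh : Continuous fun x => fderiv ℝ h x v :=
    (hh.continuous_fderiv one_ne_zero).clm_apply continuous_const
  have hdψ : Continuous fun x => fderiv ℝ ψ x v :=
    (hψ1.continuous_fderiv one_ne_zero).clm_apply continuous_const
  refine integral_mul_fderiv_eq_neg_fderiv_mul_of_integrable ?_ ?_ ?_
    (fun x _ => hh.differentiable one_ne_zero x) (fun x _ => hψ1.differentiable one_ne_zero x)
  · exact (hdh.mul hψ1.continuous).integrable_of_hasCompactSupport hψs.mul_left
  · exact (hh.continuous.mul hdψ).integrable_of_hasCompactSupport hs.mul_right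
  · exact (hh.continuous.mul hψ1.continuous).integrable_of_hasCompactSupport hs.mul_right

theorem isW012_chartGradient {h : Base n → ℝ} (hh : ContDiff ℝ 1 h)
    (hs : HasCompactSupport h) (hsA : tsupport h ⊆ A) :
    IsW012 g u (fun p => h p.1) fun p => chartGradient g u h p.1 := by
  refine ⟨⟨(hh.continuous.comp continuous_fst).aestronglyMeasurable, ?_,
    H.sobolevNormSq_chartGradient_lt_top hh hs hsA, H.isWeakGradient_chartGradient hh hs⟩,
    -- The function is its own `C¹_c` approximant, at distance zero.
    fun δ hδ => ⟨_, _, ⟨hh.contDiffOn, graphMap u '' tsupport h, ?_, Set.image_mono hsA, ?_⟩,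
      H.isGradient_chartGradient h, ?_⟩⟩
  · exact ((H.continuousOn_chartGradient hh).aestronglyMeasurable
      H.isOpen.measurableSet).comp_quasiMeasurePreserving H.quasiMeasurePreserving_fst
  · exact hs.isCompact.image_of_continuousOn (H.continuousOn_graphMap.mono hsA)
  · rintro _ ⟨x, hx, rfl⟩ hS
    exact image_eq_zero_of_notMem_tsupport (f := h) fun hx' => hS ⟨x, hx', rfl⟩
  · simpa [sobolevNormSq] using hδ

end IsControlledGraph

end Gradient

/-- The real `essInf` is a supremum of essential lower bounds, with default value `0` if there are
none; positivity excludes that case and yields a positive lower bound. -/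
theorem ae_pos_of_essInf_pos {X : Type*} [MeasurableSpace X] {μ : Measure X} {ω : X → ℝ}
    (h : 0 < essInf ω μ) : ∀ᵐ p ∂μ, 0 < ω p := by
  rw [essInf, liminf_eq] at h
  have hne : {a | ∀ᵐ p ∂μ, a ≤ ω p}.Nonempty := by
    by_contra hc
    rw [Set.not_nonempty_iff_eq_empty] at hc
    rw [hc, Real.sSup_empty] at h
    exact lt_irrefl _ h
  obtain ⟨a, ha, ha0⟩ := exists_lt_of_lt_csSup hne h
  filter_upwards [ha] with p hp using ha0.trans_le hp

/-! ### The constraint set and the lower bound for energies. -/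

section Energies

variable {n : ℕ} {A : Set (Base n)} {g : RiemannianMetricOn (cylinderOver A)} {u : Base n → ℝ}
variable {K : ℝ} {ω V : Ambient n → ℝ}

theorem IsW12.lintegral_form_lt_top
    {f : Ambient n → ℝ} {Z : Ambient n → Ambient n} (hf : IsW12 g u f Z) :
    ∫⁻ p, ENNReal.ofReal (g.form p (Z p) (Z p)) ∂graphVolume g u < ∞ := by
  refine lt_of_le_of_lt (lintegral_mono fun p => ?_) hf.finite
  exact ENNReal.ofReal_le_ofReal (by nlinarith [sq_nonneg (f p)])

theorem enorm_sq_mul_enorm (x y : ℝ) : ‖x‖ₑ ^ 2 * ‖y‖ₑ = ‖x ^ 2 * y‖ₑ := by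
  rw [enorm_mul, enorm_pow]

/-- The constraint set of the energies is not empty. -/
theorem IsControlledGraph.energies_nonempty (H : IsControlledGraph K g u) (hA : A.Nonempty)
    (hωm : AEStronglyMeasurable ω (graphVolume g u))
    (hω0 : ∀ᵐ p ∂graphVolume g u, 0 < ω p) {B : ℝ≥0∞} (hB : B ≠ ∞)
    (hsob : ∀ (f : Ambient n → ℝ) (Z : Ambient n → Ambient n), IsW012 g u f Z →
      ∫⁻ p, ‖f p‖ₑ ^ 2 * ‖ω p‖ₑ ∂graphVolume g u ≤
        B * ∫⁻ p, ENNReal.ofReal (g.form p (Z p) (Z p)) ∂graphVolume g u) :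
    (energies g u ω V).Nonempty := by
  obtain ⟨x₀, hx₀⟩ := hA
  obtain ⟨h, hsA, hs, hh, -, hx1⟩ :=
    exists_contDiff_tsupport_subset (n := 1) (H.isOpen.mem_nhds hx₀)
  have hW := H.isW012_chartGradient hh hs hsA
  have hint : Integrable (fun p : Ambient n => h p.1 ^ 2 * ω p) (graphVolume g u) := by
    refine ⟨(hW.1.measurable.pow 2).mul hωm, ?_⟩
    have h1 := hsob _ _ hW
    simp_rw [enorm_sq_mul_enorm] at h1
    exact h1.trans_lt (ENNReal.mul_lt_top hB.lt_top (hW.1.lintegral_form_lt_top))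
  have hnn : 0 ≤ᵐ[graphVolume g u] fun p : Ambient n => h p.1 ^ 2 * ω p := by
    filter_upwards [hω0] with p hp
    exact mul_nonneg (sq_nonneg _) hp.le
  set I := ∫ p, h p.1 ^ 2 * ω p ∂graphVolume g u with hI
  -- Otherwise `h` vanishes almost everywhere on `A`, although it is continuous and equals `1` at
  -- `x₀`.
  have hIpos : 0 < I := by
    refine lt_of_le_of_ne (integral_nonneg_of_ae hnn) fun h0 => ?_
    rw [hI, eq_comm, integral_eq_zero_iff_of_nonneg_ae hnn hint] at h0
    have hz : ∀ᵐ p ∂graphVolume g u, h p.1 = 0 := by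
      filter_upwards [h0, hω0] with p hp hωp
      simpa [hωp.ne'] using hp
    have hz' := H.ae_restrict_of_ae_graphVolume hz
    rw [ae_restrict_iff' H.isOpen.measurableSet] at hz'
    have hopen : IsOpen (A ∩ {x | h x ≠ 0}) :=
      H.isOpen.inter (isOpen_ne_fun hh.continuous continuous_const)
    refine (hopen.measure_pos volume ⟨x₀, hx₀, by simp [hx1]⟩).ne' (measure_mono_null ?_ hz')
    rintro x ⟨hxA, hx⟩ hc
    exact hx (hc hxA)
  set c : ℝ := (Real.sqrt I)⁻¹ with hc
  have hc2 : c ^ 2 * I = 1 := by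
    rw [hc, inv_pow, Real.sq_sqrt hIpos.le, inv_mul_cancel₀ hIpos.ne']
  have hW' := H.isW012_chartGradient (h := fun x => c * h x) (contDiff_const.mul hh)
    hs.mul_left ((tsupport_mul_subset_right (f := fun _ => c)).trans hsA)
  refine ⟨_, _, _, hW', ?_, rfl⟩
  simp_rw [mul_pow, mul_assoc]
  rw [integral_const_mul, ← hI, hc2]

/-- Every admissible energy is bounded below. -/
theorem IsControlledGraph.le_of_mem_energies (H : IsControlledGraph K g u) {B ε : ℝ} (hB : 0 < B)
    (hω0 : ∀ᵐ p ∂graphVolume g u, 0 < ω p)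
    (hsob : ∀ (f : Ambient n → ℝ) (Z : Ambient n → Ambient n), IsW012 g u f Z →
      ∫⁻ p, ‖f p‖ₑ ^ 2 * ‖ω p‖ₑ ∂graphVolume g u ≤
        ENNReal.ofReal B * ∫⁻ p, ENNReal.ofReal (g.form p (Z p) (Z p)) ∂graphVolume g u)
    (hVm : AEStronglyMeasurable V (graphVolume g u))
    (hV : ∀ᵐ p ∂graphVolume g u, |V p| ≤ ε * ω p) {r : ℝ} (hr : r ∈ energies g u ω V) :
    1 / B - ε ≤ r := by
  obtain ⟨f, Z, hf, h1, rfl⟩ := hr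
  have hfm := hf.1.measurable
  have hQnn : 0 ≤ᵐ[graphVolume g u] fun p => g.form p (Z p) (Z p) := by
    filter_upwards [H.ae_eq_graphMap_fst] with p hp
    exact RiemannianMetricOn.form_self_nonneg hp.1 _
  have hQm := H.aestronglyMeasurable_form_self hf.1.measurable_grad
  have hQlt := hf.1.lintegral_form_lt_top
  have hQ : Integrable (fun p => g.form p (Z p) (Z p)) (graphVolume g u) := by
    refine ⟨hQm, ?_⟩
    rwa [hasFiniteIntegral_iff_ofReal hQnn]
  -- The constraint itself gives integrability: the integral of a nonintegrable function is `0`, not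
  -- `1`.
  have hω : Integrable (fun p => f p ^ 2 * ω p) (graphVolume g u) := by
    by_contra hc
    rw [integral_undef hc] at h1
    exact zero_ne_one h1
  have hVle : ∀ᵐ p ∂graphVolume g u, |V p * f p ^ 2| ≤ ε * (f p ^ 2 * ω p) := by
    filter_upwards [hV] with p hp
    rw [abs_mul, abs_of_nonneg (sq_nonneg (f p))]
    nlinarith [mul_le_mul_of_nonneg_right hp (sq_nonneg (f p))]
  have hVi : Integrable (fun p => V p * f p ^ 2) (graphVolume g u) :=
    (hω.const_mul ε).mono' (hVm.mul (hfm.pow 2)) hVle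
  have hVε : ∫ p, V p * f p ^ 2 ∂graphVolume g u ≤ ε := by
    calc _ ≤ ∫ p, ε * (f p ^ 2 * ω p) ∂graphVolume g u := by
          refine integral_mono_ae hVi (hω.const_mul ε) ?_
          filter_upwards [hVle] with p hp using (le_abs_self _).trans hp
      _ = ε := by rw [integral_const_mul, h1, mul_one]
  have hlow : 1 ≤ B * ∫ p, g.form p (Z p) (Z p) ∂graphVolume g u := by
    have hnn : 0 ≤ᵐ[graphVolume g u] fun p => f p ^ 2 * ω p := by
      filter_upwards [hω0] with p hp
      exact mul_nonneg (sq_nonneg _) hp.le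
    rw [integral_eq_lintegral_of_nonneg_ae hQnn hQm, ← h1,
      integral_eq_lintegral_of_nonneg_ae hnn hω.1]
    nth_rewrite 1 [← ENNReal.toReal_ofReal hB.le]
    rw [← ENNReal.toReal_mul]
    refine ENNReal.toReal_mono (ENNReal.mul_lt_top ENNReal.ofReal_lt_top hQlt).ne
      (le_trans (lintegral_mono fun p => ?_) (hsob f Z hf))
    rw [enorm_sq_mul_enorm, Real.enorm_eq_ofReal_abs]
    exact ENNReal.ofReal_le_ofReal (le_abs_self _)
  rw [integral_sub hQ hVi]
  have : 1 / B ≤ ∫ p, g.form p (Z p) (Z p) ∂graphVolume g u := by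
    rw [div_le_iff₀ hB, mul_comm]; exact hlow
  linarith

end Energies

end NeckStability

/-! ### Choice of constants and conclusion. -/

open NeckStability
theorem mainTheorem7 (n : ℕ) (hn : 3 ≤ n) (K : ℝ) (hK : 1 ≤ K) :
    ∃ C : ℝ, 0 < C ∧ ∀ W : ℝ, 0 < W → ∃ ε : ℝ, 0 < ε ∧
      ∀ (A : Set (Base n)), IsOpen A → A.Nonempty →
      ∀ (g : RiemannianMetricOn (cylinderOver A)),
        (∀ p ∈ cylinderOver A, ∀ X : Ambient n,
          1 / K * euclideanSq X ≤ g.form p X X ∧ g.form p X X ≤ K * euclideanSq X) →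
      ∀ (T : ℝ) (u : Base n → ℝ), ContDiffOn ℝ (⊤ : ℕ∞) u A →
        (∀ x ∈ A, u x ∈ Set.Ioo (-T) T) →
        eLpNorm (gradient u) ∞ (volume.restrict A) ≤ 1 / 2 →
      ∀ (ω V : Ambient n → ℝ),
        MemLorentz (graphVolume g u) ((n : ℝ) / 2) ω →
        lorentzNorm (graphVolume g u) ((n : ℝ) / 2) ω ≤ ENNReal.ofReal W →
        0 < essInf ω (graphVolume g u) →
        MemLp V ∞ (graphVolume g u) →
        (∀ᵐ p ∂graphVolume g u, |V p| ≤ ε * ω p) →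
        0 < 1 / (C * W) ∧ 1 / (C * W) ≤ sInf (energies g u ω V) := by
  obtain ⟨C₀, hC₀⟩ := exists_weighted_sobolev_W012 n hn K
  -- Adding `1` ensures positivity, since `C₀` may be `0`.
  set C₁ : ℝ := C₀ + 1 with hC₁
  have hC₁pos : 0 < C₁ := by positivity
  -- With `B = C₁ W` and this `ε`, the bound `1 / B - ε` equals `1 / (2 C₁ W)`.
  refine ⟨2 * C₁, by positivity, fun W hW => ⟨1 / (2 * C₁ * W), by positivity, ?_⟩⟩
  intro A hA hAne g hg T u hu _ hgrad ω V hωL hωW hωinf hVL hV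
  refine ⟨by positivity, ?_⟩
  have H : IsControlledGraph K g u :=
    ⟨hK, hA, hg, hu, abs_fderiv_le_of_eLpNorm_gradient_le hA hu hgrad⟩
  have hω0 := ae_pos_of_essInf_pos hωinf
  have hsob : ∀ (f : Ambient n → ℝ) (Z : Ambient n → Ambient n), IsW012 g u f Z →
      ∫⁻ p, ‖f p‖ₑ ^ 2 * ‖ω p‖ₑ ∂graphVolume g u ≤ ENNReal.ofReal (C₁ * W) *
        ∫⁻ p, ENNReal.ofReal (g.form p (Z p) (Z p)) ∂graphVolume g u := by
    intro f Z hf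
    refine (hC₀ A g u H W hW ω hωL.1 hωW f Z hf).trans ?_
    rw [ENNReal.ofReal_mul hC₁pos.le]
    gcongr
    rw [← ENNReal.ofReal_coe_nnreal]
    exact ENNReal.ofReal_le_ofReal (by linarith)
  -- Nonemptiness is essential: `sInf ∅ = 0` in `ℝ` would violate the bound.
  refine le_csInf (H.energies_nonempty hAne hωL.1 hω0 ENNReal.ofReal_ne_top hsob) fun r hr => ?_
  refine le_trans (le_of_eq ?_)
    (H.le_of_mem_energies (mul_pos hC₁pos hW) hω0 hsob hVL.1 hV hr)
  field_simp
  ring
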